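/- **Theorem.** For a nonempty compact set $\sigma\subseteq\mathbb C=\mathbb R^2$, a function $f:\sigma\to\mathbb C$ and a finite list $S=[x_0,\dots,x_n]$ of (not necessarily distinct) points of $\sigma$, put $\operatorname{cvar}(f,S)=\sum_{i=1}^n|f(x_i)-f(x_{i-1})|$. For a line $\ell$ in the plane and $n\ge 1$, let $\operatorname{vf}(S,\ell)$ be the number of indices $0\le i\le n-1$ such that at least one of the following holds: (i) $x_i$ and $x_{i+1}$ lie strictly on opposite sides of $\ell$; (ii) $i=0$ and $x_i\in\ell$; (iii) $i>0$, $x_i\in\ell$ and $x_{i-1}\notin\ell$; (iv) $i=n-1$, $x_i\notin\ell$ and $x_{i+1}\in\ell$. For $n=0$ let $\operatorname{vf}(S,\ell)$ be $1$ if $x_0\in\ell$ and $0$ otherwise. Let $\operatorname{vf}(S)=\max_\ell\operatorname{vf}(S,\ell)$, the maximum being over all lines $\ell$ in the plane, let $\operatorname{var}(f,\sigma)=\sup_S \operatorname{cvar}(f,S)/\operatorname{vf}(S)$, the supremum being over all finite lists of points of $\sigma$, and let $\|f\|_{BV(\sigma)}=\|f\|_\infty+\operatorname{var}(f,\sigma)$.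 Let $BV(\sigma)$ be the algebra, under pointwise operations, of all $f:\sigma\to\mathbb C$ with $\|f\|_{BV(\sigma)}<\infty$, normed by $\|\cdot\|_{BV(\sigma)}$, and let $AC(\sigma)$ be the closure in $BV(\sigma)$ of the set of restrictions to $\sigma$ of the polynomials $\sum_{n,m}c_{nm}x^ny^m$ ($c_{nm}\in\mathbb C$) in the two real coordinates $x,y$. Then $AC(\sigma)$ is a Banach algebra with the norm $\|\cdot\|_{BV(\sigma)}$. Write $AC(\sigma)\simeq AC(\tau)$ if there is a linear and multiplicative bijection $\Phi:AC(\sigma)\to AC(\tau)$ such that $\Phi$ and $\Phi^{-1}$ are continuous. For a positive integer $k$, a $k$-ray set is a countably infinite compact set $\sigma\subseteq\mathbb C$ whose unique limit point is $0$ and for which there are $k$ distinct rays $R_{\theta_j}=\{te^{i\theta_j}: t\ge 0\}$, $\theta_j\in[0,2\pi)$, $j=1,\dots,k$, such that $\sigma\cap R_{\theta_j}$ is infinite for each $j$ and $\sigma\setminus(R_{\theta_1}\cup\dots\cup R_{\theta_k})$ is finite. Let $k,\ell$ be positive integers, let $\sigma$ be a $k$-ray set and let $\tau$ be an $\ell$-ray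 set. Then $AC(\sigma)\simeq AC(\tau)$ if and only if $k=\ell$. -/

import Mathlib

open scoped ENNReal

/-! ### Lines, crossing segments and the variation factor -/

/-- Data `(a, b, c)` with `(a, b) ≠ (0, 0)` of a line `{z | a * Re z + b * Im z = c}` in the plane. -/
structure PlaneLine where
  a : ℝ
  b : ℝ
  c : ℝ
  ne_zero : a ≠ 0 ∨ b ≠ 0

/-- The affine form of a line: it vanishes on the line and has opposite signs on its two sides. -/
def PlaneLine.form (L : PlaneLine) (z : ℂ) : ℝ := L.a * z.re + L.b * z.im - L.c

/-- `z` lies on the line `L`. -/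
def PlaneLine.Has (L : PlaneLine) (z : ℂ) : Prop := L.form z = 0

/-- For the list `[x 0, …, x n]`, the segment joining `x i` to `x (i + 1)` (where `i < n`) is a
crossing segment on the line `L`. -/
def IsCrossingSegment (n : ℕ) (x : ℕ → ℂ) (L : PlaneLine) (i : ℕ) : Prop :=
  L.form (x i) * L.form (x (i + 1)) < 0 ∨
  (i = 0 ∧ L.Has (x i)) ∨
  (0 < i ∧ L.Has (x i) ∧ ¬ L.Has (x (i - 1))) ∨
  (i + 1 = n ∧ ¬ L.Has (x i) ∧ L.Has (x (i + 1)))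

open Classical in
/-- The number `vf(S, L)` of crossing segments of the list `S = [x 0, …, x n]` on the line `L`;
for a one-element list it is `1` if the point lies on `L`, and `0` otherwise. -/
noncomputable def crossingCount (n : ℕ) (x : ℕ → ℂ) (L : PlaneLine) : ℕ :=
  if n = 0 then (if L.Has (x 0) then 1 else 0)
  else ((Finset.range n).filter (fun i => IsCrossingSegment n x L i)).card

/-- The variation factor `vf(S)` of the list `S = [x 0, …, x n]`: the maximum of `vf(S, L)` over
all lines `L`. -/
noncomputable def variationFactor (n : ℕ) (x : ℕ → ℂ) : ℕ := ⨆ L : PlaneLine, crossingCount n x L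

theorem crossingCount_le (n : ℕ) (x : ℕ → ℂ) (L : PlaneLine) : crossingCount n x L ≤ n + 1 := by
  classical
  unfold crossingCount
  split_ifs
  · omega
  · omega
  · exact (Finset.card_filter_le _ _).trans (by simp)

theorem bddAbove_crossingCount (n : ℕ) (x : ℕ → ℂ) :
    BddAbove (Set.range fun L : PlaneLine => crossingCount n x L) :=
  ⟨n + 1, by rintro _ ⟨L, rfl⟩; exact crossingCount_le n x L⟩

theorem crossingCount_le_variationFactor (n : ℕ) (x : ℕ → ℂ) (L : PlaneLine) :
    crossingCount n x L ≤ variationFactor n x :=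
  le_ciSup (bddAbove_crossingCount n x) L

theorem one_le_variationFactor (n : ℕ) (x : ℕ → ℂ) : 1 ≤ variationFactor n x := by
  classical
  let L : PlaneLine := ⟨1, 0, (x 0).re, Or.inl one_ne_zero⟩
  have hL : L.Has (x 0) := by simp [L, PlaneLine.Has, PlaneLine.form]
  refine le_trans ?_ (crossingCount_le_variationFactor n x L)
  unfold crossingCount
  split_ifs with h
  · exact le_rfl
  · refine Finset.card_pos.mpr ⟨0, ?_⟩
    simp only [Finset.mem_filter, Finset.mem_range]
    exact ⟨Nat.pos_of_ne_zero h, Or.inr (Or.inl ⟨rfl, hL⟩)⟩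

/-! ### Functions of bounded variation -/

/-- The curve variation of `f` on the list `[x 0, …, x n]` of points of `σ`. -/
noncomputable def curveVariation {σ : Set ℂ} (f : σ → ℂ) (n : ℕ) (x : ℕ → σ) : ℝ≥0∞ :=
  ∑ i ∈ Finset.range n, ‖f (x (i + 1)) - f (x i)‖ₑ

/-- The two-dimensional variation of `f : σ → ℂ`: the supremum, over all finite ordered lists
`S = [x 0, …, x n]` in `σ`, of the curve variation divided by the variation factor.
(The terms of the sequence `x` after `x n` play no role.) -/
noncomputable def planarVariation {σ : Set ℂ} (f : σ → ℂ) : ℝ≥0∞ :=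
  ⨆ (n : ℕ) (x : ℕ → σ), curveVariation f n x / (variationFactor n (fun i => (x i : ℂ)) : ℝ≥0∞)

/-- `f` is bounded and has finite two-dimensional variation. -/
def HasBoundedPlanarVariation {σ : Set ℂ} (f : σ → ℂ) : Prop :=
  BddAbove (Set.range fun z => ‖f z‖) ∧ planarVariation f ≠ ∞

/-- The variation norm `‖f‖_∞ + var(f, σ)`. -/
noncomputable def bvNorm {σ : Set ℂ} (f : σ → ℂ) : ℝ :=
  (⨆ z, ‖f z‖) + (planarVariation f).toReal

section lemmas

variable {σ : Set ℂ}

theorem planarVariation_le_iff {f : σ → ℂ} {C : ℝ≥0∞} :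
    planarVariation f ≤ C ↔ ∀ (n : ℕ) (x : ℕ → σ),
      curveVariation f n x ≤ C * (variationFactor n (fun i => (x i : ℂ)) : ℝ≥0∞) := by
  unfold planarVariation
  simp only [iSup_le_iff]
  refine forall_congr' fun n => forall_congr' fun x => ?_
  refine ENNReal.div_le_iff ?_ (ENNReal.natCast_ne_top _)
  have := one_le_variationFactor n (fun i => (x i : ℂ))
  exact_mod_cast (by omega : variationFactor n (fun i => (x i : ℂ)) ≠ 0)

theorem curveVariation_le (f : σ → ℂ) (n : ℕ) (x : ℕ → σ) :
    curveVariation f n x ≤ planarVariation f * (variationFactor n (fun i => (x i : ℂ)) : ℝ≥0∞) :=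
  planarVariation_le_iff.1 le_rfl n x

theorem planarVariation_add_le (f g : σ → ℂ) :
    planarVariation (f + g) ≤ planarVariation f + planarVariation g := by
  refine planarVariation_le_iff.2 fun n x => ?_
  rw [add_mul]
  refine le_trans ?_ (add_le_add (curveVariation_le f n x) (curveVariation_le g n x))
  unfold curveVariation
  rw [← Finset.sum_add_distrib]
  refine Finset.sum_le_sum fun i _ => ?_
  refine le_trans (le_of_eq ?_) (enorm_add_le _ _)
  congr 1
  simp only [Pi.add_apply]
  ring

theorem planarVariation_mul_le {f g : σ → ℂ} {A B : ℝ≥0∞} (hf : ∀ z, ‖f z‖ₑ ≤ A)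
    (hg : ∀ z, ‖g z‖ₑ ≤ B) :
    planarVariation (f * g) ≤ A * planarVariation g + B * planarVariation f := by
  refine planarVariation_le_iff.2 fun n x => ?_
  rw [add_mul, mul_assoc, mul_assoc]
  refine le_trans ?_ (add_le_add (mul_le_mul_right (curveVariation_le g n x) A)
    (mul_le_mul_right (curveVariation_le f n x) B))
  unfold curveVariation
  rw [Finset.mul_sum, Finset.mul_sum, ← Finset.sum_add_distrib]
  refine Finset.sum_le_sum fun i _ => ?_
  have h : (f * g) (x (i + 1)) - (f * g) (x i) =
      f (x (i + 1)) * (g (x (i + 1)) - g (x i)) + g (x i) * (f (x (i + 1)) - f (x i)) := by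
    simp only [Pi.mul_apply]
    ring
  rw [h]
  refine (enorm_add_le _ _).trans ?_
  rw [enorm_mul, enorm_mul]
  exact add_le_add (mul_le_mul_left (hf _) _) (mul_le_mul_left (hg _) _)

theorem planarVariation_const (c : ℂ) : planarVariation (fun _ : σ => c) = 0 := by
  refine le_antisymm (planarVariation_le_iff.2 fun n x => ?_) bot_le
  simp [curveVariation]

theorem planarVariation_smul_le (c : ℂ) (f : σ → ℂ) :
    planarVariation (c • f) ≤ ‖c‖ₑ * planarVariation f := by
  refine planarVariation_le_iff.2 fun n x => ?_
  rw [mul_assoc]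
  refine le_trans (le_of_eq ?_) (mul_le_mul_right (curveVariation_le f n x) _)
  unfold curveVariation
  rw [Finset.mul_sum]
  refine Finset.sum_congr rfl fun i _ => ?_
  rw [← enorm_mul]
  congr 1
  simp only [Pi.smul_apply, smul_eq_mul]
  ring

theorem planarVariation_neg (f : σ → ℂ) : planarVariation (-f) = planarVariation f := by
  have h : ∀ f : σ → ℂ, planarVariation (-f) ≤ planarVariation f := fun f => by
    simpa using planarVariation_smul_le (-1) f
  exact le_antisymm (h f) (by simpa using h (-f))

theorem HasBoundedPlanarVariation.norm_le {f : σ → ℂ} (hf : HasBoundedPlanarVariation f) (z : σ) :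
    ‖f z‖ ≤ ⨆ z, ‖f z‖ := le_ciSup hf.1 z

theorem HasBoundedPlanarVariation.enorm_le {f : σ → ℂ} (hf : HasBoundedPlanarVariation f)
    (z : σ) : ‖f z‖ₑ ≤ ENNReal.ofReal (⨆ z, ‖f z‖) := by
  rw [← ofReal_norm]
  exact ENNReal.ofReal_le_ofReal (hf.norm_le z)

theorem iSup_norm_nonneg (f : σ → ℂ) : 0 ≤ ⨆ z, ‖f z‖ := Real.iSup_nonneg fun _ => norm_nonneg _

theorem HasBoundedPlanarVariation.const (c : ℂ) :
    HasBoundedPlanarVariation (fun _ : σ => c) :=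
  ⟨⟨‖c‖, by rintro _ ⟨z, rfl⟩; exact le_rfl⟩, by rw [planarVariation_const]; exact ENNReal.zero_ne_top⟩

theorem HasBoundedPlanarVariation.add {f g : σ → ℂ} (hf : HasBoundedPlanarVariation f)
    (hg : HasBoundedPlanarVariation g) : HasBoundedPlanarVariation (f + g) := by
  refine ⟨⟨(⨆ z, ‖f z‖) + ⨆ z, ‖g z‖, ?_⟩, ?_⟩
  · rintro _ ⟨z, rfl⟩
    exact (norm_add_le _ _).trans (add_le_add (hf.norm_le z) (hg.norm_le z))
  · exact ne_top_of_le_ne_top (ENNReal.add_ne_top.2 ⟨hf.2, hg.2⟩) (planarVariation_add_le f g)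

theorem HasBoundedPlanarVariation.mul {f g : σ → ℂ} (hf : HasBoundedPlanarVariation f)
    (hg : HasBoundedPlanarVariation g) : HasBoundedPlanarVariation (f * g) := by
  refine ⟨⟨(⨆ z, ‖f z‖) * ⨆ z, ‖g z‖, ?_⟩, ?_⟩
  · rintro _ ⟨z, rfl⟩
    exact (norm_mul_le _ _).trans
      (mul_le_mul (hf.norm_le z) (hg.norm_le z) (norm_nonneg _) (iSup_norm_nonneg f))
  · exact ne_top_of_le_ne_top (ENNReal.add_ne_top.2 ⟨ENNReal.mul_ne_top ENNReal.ofReal_ne_top hg.2,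
      ENNReal.mul_ne_top ENNReal.ofReal_ne_top hf.2⟩)
      (planarVariation_mul_le hf.enorm_le hg.enorm_le)

theorem bvNorm_nonneg (f : σ → ℂ) : 0 ≤ bvNorm f :=
  add_nonneg (iSup_norm_nonneg f) ENNReal.toReal_nonneg

theorem bvNorm_zero : bvNorm (0 : σ → ℂ) = 0 := by
  have h : planarVariation (0 : σ → ℂ) = 0 := planarVariation_const 0
  simp [bvNorm, h]

theorem bvNorm_neg (f : σ → ℂ) : bvNorm (-f) = bvNorm f := by
  simp [bvNorm, planarVariation_neg]

theorem bvNorm_add_le {f g : σ → ℂ} (hf : HasBoundedPlanarVariation f)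
    (hg : HasBoundedPlanarVariation g) : bvNorm (f + g) ≤ bvNorm f + bvNorm g := by
  have h1 : (⨆ z, ‖(f + g) z‖) ≤ (⨆ z, ‖f z‖) + ⨆ z, ‖g z‖ :=
    Real.iSup_le (fun z => (norm_add_le _ _).trans (add_le_add (hf.norm_le z) (hg.norm_le z)))
      (add_nonneg (iSup_norm_nonneg f) (iSup_norm_nonneg g))
  have h2 : (planarVariation (f + g)).toReal ≤
      (planarVariation f).toReal + (planarVariation g).toReal := by
    rw [← ENNReal.toReal_add hf.2 hg.2]
    exact ENNReal.toReal_mono (ENNReal.add_ne_top.2 ⟨hf.2, hg.2⟩) (planarVariation_add_le f g)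
  unfold bvNorm
  linarith

theorem bvNorm_mul_le {f g : σ → ℂ} (hf : HasBoundedPlanarVariation f)
    (hg : HasBoundedPlanarVariation g) : bvNorm (f * g) ≤ bvNorm f * bvNorm g := by
  have hF := iSup_norm_nonneg f
  have hG := iSup_norm_nonneg g
  have h1 : (⨆ z, ‖(f * g) z‖) ≤ (⨆ z, ‖f z‖) * ⨆ z, ‖g z‖ :=
    Real.iSup_le (fun z => (norm_mul_le _ _).trans
      (mul_le_mul (hf.norm_le z) (hg.norm_le z) (norm_nonneg _) hF)) (mul_nonneg hF hG)
  have t1 := ENNReal.mul_ne_top (ENNReal.ofReal_ne_top (r := ⨆ z, ‖f z‖)) hg.2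
  have t2 := ENNReal.mul_ne_top (ENNReal.ofReal_ne_top (r := ⨆ z, ‖g z‖)) hf.2
  have h2 : (planarVariation (f * g)).toReal ≤
      (⨆ z, ‖f z‖) * (planarVariation g).toReal + (⨆ z, ‖g z‖) * (planarVariation f).toReal := by
    have := ENNReal.toReal_mono (ENNReal.add_ne_top.2 ⟨t1, t2⟩)
      (planarVariation_mul_le hf.enorm_le hg.enorm_le)
    rwa [ENNReal.toReal_add t1 t2, ENNReal.toReal_mul, ENNReal.toReal_mul,
      ENNReal.toReal_ofReal hF, ENNReal.toReal_ofReal hG] at this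
  have h3 : 0 ≤ (planarVariation f).toReal * (planarVariation g).toReal := by positivity
  unfold bvNorm
  nlinarith

theorem bvNorm_smul_le (c : ℂ) {f : σ → ℂ} (hf : HasBoundedPlanarVariation f) :
    bvNorm (c • f) ≤ ‖c‖ * bvNorm f := by
  have h1 : (⨆ z, ‖(c • f) z‖) ≤ ‖c‖ * ⨆ z, ‖f z‖ :=
    Real.iSup_le (fun z => (norm_smul_le _ _).trans
      (mul_le_mul_of_nonneg_left (hf.norm_le z) (norm_nonneg c)))
      (mul_nonneg (norm_nonneg _) (iSup_norm_nonneg f))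
  have h2 : (planarVariation (c • f)).toReal ≤ ‖c‖ * (planarVariation f).toReal := by
    have := ENNReal.toReal_mono (ENNReal.mul_ne_top enorm_ne_top hf.2)
      (planarVariation_smul_le c f)
    rwa [ENNReal.toReal_mul, toReal_enorm] at this
  unfold bvNorm
  linarith

theorem eq_zero_of_bvNorm_eq_zero {f : σ → ℂ} (hf : HasBoundedPlanarVariation f)
    (h : bvNorm f = 0) : f = 0 := by
  funext z
  have h0 : 0 ≤ (planarVariation f).toReal := ENNReal.toReal_nonneg
  have h1 := hf.norm_le z
  unfold bvNorm at h
  exact norm_le_zero_iff.1 (by linarith)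

end lemmas

/-- The functions of bounded variation on `σ`, as a subalgebra of all functions `σ → ℂ`. -/
def bvSubalgebra (σ : Set ℂ) : Subalgebra ℂ (σ → ℂ) where
  carrier := {f | HasBoundedPlanarVariation f}
  mul_mem' := HasBoundedPlanarVariation.mul
  add_mem' := HasBoundedPlanarVariation.add
  algebraMap_mem' c := HasBoundedPlanarVariation.const c

/-- The algebra `BV(σ)`, to be normed by the variation norm. It is a type of its own in order not
to inherit the topology of pointwise convergence from `σ → ℂ`. -/
def BV (σ : Set ℂ) : Type := bvSubalgebra σ

noncomputable instance (σ : Set ℂ) : CommRing (BV σ) := inferInstanceAs (CommRing (bvSubalgebra σ))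

noncomputable instance (σ : Set ℂ) : Algebra ℂ (BV σ) :=
  inferInstanceAs (Algebra ℂ (bvSubalgebra σ))

/-- The inclusion of `BV(σ)` in the algebra of all functions `σ → ℂ`. -/
noncomputable def BV.val (σ : Set ℂ) : BV σ →ₐ[ℂ] (σ → ℂ) := (bvSubalgebra σ).val

theorem BV.property {σ : Set ℂ} (f : BV σ) : HasBoundedPlanarVariation (BV.val σ f) :=
  Subtype.property (p := fun f => f ∈ bvSubalgebra σ) f

theorem BV.val_injective (σ : Set ℂ) : Function.Injective (BV.val σ) := Subtype.val_injective

theorem BV.range_val (σ : Set ℂ) :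
    Set.range (BV.val σ) = {f | HasBoundedPlanarVariation f} := Subtype.range_val

/-- The variation norm on `BV(σ)`. -/
noncomputable def BV.ringNorm (σ : Set ℂ) : RingNorm (BV σ) where
  toFun f := bvNorm (BV.val σ f)
  map_zero' := by rw [map_zero, bvNorm_zero]
  add_le' f g := by rw [map_add]; exact bvNorm_add_le f.property g.property
  neg' f := by rw [map_neg, bvNorm_neg]
  mul_le' f g := by rw [map_mul]; exact bvNorm_mul_le f.property g.property
  eq_zero_of_map_eq_zero' f h :=
    BV.val_injective σ (by rw [map_zero]; exact eq_zero_of_bvNorm_eq_zero f.property h)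

noncomputable instance (σ : Set ℂ) : NormedCommRing (BV σ) where
  __ := (BV.ringNorm σ).toNormedRing
  mul_comm := mul_comm

theorem BV.norm_def {σ : Set ℂ} (f : BV σ) : ‖f‖ = bvNorm (BV.val σ f) := rfl

noncomputable instance (σ : Set ℂ) : NormedAlgebra ℂ (BV σ) where
  norm_smul_le c f := by
    rw [BV.norm_def, BV.norm_def, map_smul]
    exact bvNorm_smul_le c f.property

/-! ### Absolutely continuous functions -/

/-- The restrictions to `σ` of the polynomials `p(x, y)` in two real variables with complex
coefficients, where `z = x + i y`. -/
noncomputable def polySubalgebra (σ : Set ℂ) : Subalgebra ℂ (σ → ℂ) :=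
  (MvPolynomial.aeval (R := ℂ)
    ![(fun z : σ => (((z : ℂ).re : ℝ) : ℂ)), (fun z : σ => (((z : ℂ).im : ℝ) : ℂ))]).range

/-- The algebra `AC(σ)`: the closure, in the variation norm, of the restrictions to `σ` of the
polynomials in two real variables. (If `σ` is compact, all of these lie in `BV(σ)`, see
`polySubalgebra_le_bvSubalgebra`.) -/
noncomputable def AC (σ : Set ℂ) : Subalgebra ℂ (BV σ) :=
  ((polySubalgebra σ).comap (BV.val σ)).topologicalClosure

section polynomials

variable {σ : Set ℂ}

open MeasureTheory in
theorem hasBoundedPlanarVariation_linear (hσ : Bornology.IsBounded σ) (a b : ℝ)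
    (hab : a ≠ 0 ∨ b ≠ 0) :
    HasBoundedPlanarVariation (fun z : σ => ((a * (z : ℂ).re + b * (z : ℂ).im : ℝ) : ℂ)) := by
  classical
  set φ : ℂ → ℝ := fun z => a * z.re + b * z.im with hφ
  obtain ⟨R, hR⟩ := hσ.exists_norm_le
  set M : ℝ := (|a| + |b|) * R with hM
  have hbd : ∀ z ∈ σ, |φ z| ≤ M := fun z hz => by
    have h1 := (Complex.abs_re_le_norm z).trans (hR z hz)
    have h2 := (Complex.abs_im_le_norm z).trans (hR z hz)
    calc |φ z| ≤ |a * z.re| + |b * z.im| := abs_add_le _ _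
      _ = |a| * |z.re| + |b| * |z.im| := by rw [abs_mul, abs_mul]
      _ ≤ |a| * R + |b| * R := by gcongr
      _ = M := by rw [hM]; ring
  refine ⟨⟨M, ?_⟩, ?_⟩
  · rintro _ ⟨z, rfl⟩
    simpa [Complex.norm_real, -Complex.ofReal_add, -Complex.ofReal_mul] using hbd z z.2
  refine ne_top_of_le_ne_top (b := ENNReal.ofReal (2 * M)) ENNReal.ofReal_ne_top
    (planarVariation_le_iff.2 fun n x => ?_)
  set V := variationFactor n (fun i => (x i : ℂ)) with hV
  let J : ℕ → Set ℝ := fun i => Set.Ioo (min (φ (x i)) (φ (x (i + 1)))) (max (φ (x i)) (φ (x (i + 1))))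
  have hJ : ∀ i t, t ∈ J i → (φ (x i) - t) * (φ (x (i + 1)) - t) < 0 := fun i t ht => by
    rcases le_total (φ (x i)) (φ (x (i + 1))) with h | h
    · have ht' : t ∈ Set.Ioo _ _ := ht
      rw [min_eq_left h, max_eq_right h] at ht'
      nlinarith [ht'.1, ht'.2, mul_pos (sub_pos.2 ht'.1) (sub_pos.2 ht'.2)]
    · have ht' : t ∈ Set.Ioo _ _ := ht
      rw [min_eq_right h, max_eq_left h] at ht'
      nlinarith [ht'.1, ht'.2, mul_pos (sub_pos.2 ht'.1) (sub_pos.2 ht'.2)]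
  have hcount : ∀ t : ℝ, ∑ i ∈ Finset.range n, (J i).indicator (1 : ℝ → ℝ≥0∞) t ≤
      (Set.Icc (-M) M).indicator (fun _ => (V : ℝ≥0∞)) t := fun t => by
    by_cases ht : t ∈ Set.Icc (-M) M
    · rw [Set.indicator_of_mem ht]
      have hsum : ∑ i ∈ Finset.range n, (J i).indicator (1 : ℝ → ℝ≥0∞) t =
          (((Finset.range n).filter (fun i => t ∈ J i)).card : ℝ≥0∞) := by
        rw [Finset.card_filter, Nat.cast_sum]
        refine Finset.sum_congr rfl fun i _ => ?_
        by_cases h : t ∈ J i <;> simp [h]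
      rw [hsum]
      let L : PlaneLine := ⟨a, b, t, hab⟩
      rcases Nat.eq_zero_or_pos n with h0 | h0
      · simp [h0]
      · have : ((Finset.range n).filter (fun i => t ∈ J i)).card ≤ V := by
          refine le_trans ?_ (crossingCount_le_variationFactor n _ L)
          rw [crossingCount, if_neg h0.ne']
          refine Finset.card_le_card fun i hi => ?_
          simp only [Finset.mem_filter] at hi ⊢
          exact ⟨hi.1, Or.inl (hJ i t hi.2)⟩
        exact_mod_cast this
    · rw [Set.indicator_of_notMem ht]
      refine le_of_eq (Finset.sum_eq_zero fun i _ => Set.indicator_of_notMem (fun h => ht ?_) _)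
      have h1 := abs_le.1 (hbd _ (x i).2)
      have h2 := abs_le.1 (hbd _ (x (i + 1)).2)
      exact ⟨(le_min h1.1 h2.1).trans h.1.le, h.2.le.trans (max_le h1.2 h2.2)⟩
  calc curveVariation _ n x = ∑ i ∈ Finset.range n, volume (J i) := by
        unfold curveVariation
        refine Finset.sum_congr rfl fun i _ => ?_
        rw [Real.volume_Ioo, max_sub_min_eq_abs, ← Complex.ofReal_sub, ← ofReal_norm,
          Complex.norm_real, Real.norm_eq_abs]
    _ = ∑ i ∈ Finset.range n, ∫⁻ t, (J i).indicator (1 : ℝ → ℝ≥0∞) t :=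
        Finset.sum_congr rfl fun i _ => (lintegral_indicator_one measurableSet_Ioo).symm
    _ = ∫⁻ t, ∑ i ∈ Finset.range n, (J i).indicator (1 : ℝ → ℝ≥0∞) t :=
        (lintegral_finsetSum _ fun i _ => measurable_one.indicator measurableSet_Ioo).symm
    _ ≤ ∫⁻ t, (Set.Icc (-M) M).indicator (fun _ => (V : ℝ≥0∞)) t := lintegral_mono hcount
    _ = ENNReal.ofReal (2 * M) * V := by
        rw [lintegral_indicator_const measurableSet_Icc, Real.volume_Icc, mul_comm]
        congr 2
        ring

/-- On a bounded set every polynomial in two real variables is of bounded variation. -/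
theorem polySubalgebra_le_bvSubalgebra (hσ : Bornology.IsBounded σ) :
    polySubalgebra σ ≤ bvSubalgebra σ := by
  rw [polySubalgebra, ← Algebra.adjoin_range_eq_range_aeval, Algebra.adjoin_le_iff]
  rintro _ ⟨i, rfl⟩
  change HasBoundedPlanarVariation _
  fin_cases i
  · simpa using hasBoundedPlanarVariation_linear hσ 1 0 (Or.inl one_ne_zero)
  · simpa using hasBoundedPlanarVariation_linear hσ 0 1 (Or.inr one_ne_zero)

end polynomials

/-! ### Ray sets -/

/-- A `C`-set: a countably infinite compact subset of the plane with `0` as its unique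
limit point. -/
def IsCSet (σ : Set ℂ) : Prop :=
  σ.Countable ∧ σ.Infinite ∧ IsCompact σ ∧ ∀ z : ℂ, AccPt z (Filter.principal σ) ↔ z = 0

/-- The ray `{t e^{iθ} | t ≥ 0}`. -/
def ray (θ : ℝ) : Set ℂ := {z | ∃ t : ℝ, 0 ≤ t ∧ z = t * Complex.exp (θ * Complex.I)}

/-- A `k`-ray set: a `C`-set for which there are `k` distinct rays from the origin, each containing
infinitely many of its points, such that only finitely many of its points lie on none of them. -/
def IsRaySet (k : ℕ) (σ : Set ℂ) : Prop :=
  IsCSet σ ∧ 0 < k ∧ ∃ θ : Fin k → ℝ,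
    Function.Injective θ ∧ (∀ j, θ j ∈ Set.Ico 0 (2 * Real.pi)) ∧
    (∀ j, (σ ∩ ray (θ j)).Infinite) ∧ (σ \ ⋃ j, σ ∩ ray (θ j)).Finite

/-! Up to an equivalent norm, `AC σ` for a `k`-ray set is the algebra of `k`-tuples of sequences of
bounded variation with a common limit, the value at `0`. Only the number of sequences remains
visible.

List the nonzero points of `σ` by `k` sequences, each running down one ray, with the finitely many
exceptional points put in front of one of them. Two estimates, recorded in `RayEnumeration`, carry
the proof. A monotone list on a ray meets any line in at most four crossing segments
(`variationFactor_le_four`), so the variation of `f` along each sequence is at most a constant times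
`bvNorm f`. Conversely, indicators of initial segments of the sequences have uniformly bounded
variation: `k` lines and finitely many point indicators tell such a segment apart from the rest of
`σ` (`planarVariation_le_of_separated`). By Abel summation a function is a constant plus a
combination of these indicators with its successive differences as coefficients, so finite variation
along the sequences and continuity at `0` along them already give absolute continuity, with a norm
bound (`RayEnumeration.isPlanarAC_of_sum_le`). If `k = l`, composition with the bijection that
matches two enumerations is therefore an isomorphism.

For the converse, an isomorphism carries point indicators, the minimal idempotents, to point
indicators (`AC.exists_map_point_eq`). The image in `τ` of a sequence of `σ` again has initial
indicators of bounded norm, so every sequence of `τ` is eventually inside or eventually outside this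
image. The image is infinite, so some sequence of `τ` ends up inside it; different sequences of `σ`
have disjoint images and claim different sequences of `τ`. Hence `k ≤ l`, and equality follows by
symmetry. -/

/-! ### Tools for the variation and for membership in `AC` -/

open Filter Topology in
theorem planarVariation_le_of_tendsto {σ : Set ℂ} {g : ℕ → σ → ℂ} {f : σ → ℂ} {B : ℝ≥0∞}
    (h : ∀ z, Tendsto (fun n => g n z) atTop (𝓝 (f z))) (hB : ∀ᶠ n in atTop, planarVariation (g n) ≤ B) :
    planarVariation f ≤ B := by
  refine planarVariation_le_iff.2 fun n x => ?_
  -- For a fixed list only finitely many values enter, so pointwise convergence suffices: the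
  -- variation is lower semicontinuous.
  have ht : Tendsto (fun m => curveVariation (g m) n x) atTop (𝓝 (curveVariation f n x)) :=
    tendsto_finsetSum _ fun i _ => ((h _).sub (h _)).enorm
  refine le_of_tendsto ht (hB.mono fun m hm => ?_)
  exact planarVariation_le_iff.1 hm n x

theorem planarVariation_le_of_enorm_sub_le {σ : Set ℂ} {f g : σ → ℂ} {K : ℝ≥0∞}
    (h : ∀ x y, ‖f x - f y‖ₑ ≤ K * ‖g x - g y‖ₑ) : planarVariation f ≤ K * planarVariation g := by
  refine planarVariation_le_iff.2 fun n x => ?_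
  rw [mul_assoc]
  refine le_trans ?_ (mul_le_mul_right (curveVariation_le g n x) K)
  unfold curveVariation
  rw [Finset.mul_sum]
  exact Finset.sum_le_sum fun i _ => h _ _

theorem planarVariation_sum_le {ι : Type*} {σ : Set ℂ} (s : Finset ι) (f : ι → σ → ℂ) :
    planarVariation (∑ i ∈ s, f i) ≤ ∑ i ∈ s, planarVariation (f i) := by
  classical
  induction s using Finset.induction_on with
  | empty => exact (planarVariation_const (σ := σ) 0).le
  | insert a s ha ih =>
    rw [Finset.sum_insert ha, Finset.sum_insert ha]
    exact (planarVariation_add_le _ _).trans (by gcongr)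

theorem HasBoundedPlanarVariation.norm_le_bvNorm {σ : Set ℂ} {f : σ → ℂ}
    (hf : HasBoundedPlanarVariation f) (z : σ) : ‖f z‖ ≤ bvNorm f :=
  (hf.norm_le z).trans (le_add_of_nonneg_right ENNReal.toReal_nonneg)

theorem HasBoundedPlanarVariation.of_le {σ : Set ℂ} {f : σ → ℂ} {A B : ℝ} (hA : ∀ z, ‖f z‖ ≤ A)
    (hB : planarVariation f ≤ ENNReal.ofReal B) : HasBoundedPlanarVariation f :=
  ⟨⟨A, by rintro _ ⟨z, rfl⟩; exact hA z⟩, ne_top_of_le_ne_top ENNReal.ofReal_ne_top hB⟩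

theorem bvNorm_le_of_le {σ : Set ℂ} {f : σ → ℂ} {A B : ℝ} (hA0 : 0 ≤ A) (hB0 : 0 ≤ B)
    (hA : ∀ z, ‖f z‖ ≤ A) (hB : planarVariation f ≤ ENNReal.ofReal B) : bvNorm f ≤ A + B :=
  add_le_add (Real.iSup_le hA hA0) (ENNReal.toReal_le_of_le_ofReal hB0 hB)

theorem BV.norm_apply_le {σ : Set ℂ} (f : BV σ) (z : σ) : ‖BV.val σ f z‖ ≤ ‖f‖ :=
  f.property.norm_le_bvNorm z

/-- A function of bounded variation as an element of the algebra `BV σ`. -/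
def BV.mk {σ : Set ℂ} (f : σ → ℂ) (hf : HasBoundedPlanarVariation f) : BV σ :=
  (⟨f, hf⟩ : bvSubalgebra σ)

/-- A function belongs to `AC(σ)`. -/
def IsPlanarAC {σ : Set ℂ} (f : σ → ℂ) : Prop := ∃ g ∈ AC σ, BV.val σ g = f

theorem IsPlanarAC.hasBoundedPlanarVariation {σ : Set ℂ} {f : σ → ℂ} (hf : IsPlanarAC f) :
    HasBoundedPlanarVariation f := by
  obtain ⟨g, -, rfl⟩ := hf
  exact g.property

theorem IsPlanarAC.mk_mem {σ : Set ℂ} {f : σ → ℂ} (hf : IsPlanarAC f) :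
    BV.mk f hf.hasBoundedPlanarVariation ∈ AC σ := by
  obtain ⟨g, hg, rfl⟩ := hf
  exact hg

theorem isPlanarAC_const {σ : Set ℂ} (c : ℂ) : IsPlanarAC (fun _ : σ => c) :=
  ⟨algebraMap ℂ _ c, (AC σ).algebraMap_mem c, by rw [AlgHom.commutes]; rfl⟩

theorem IsPlanarAC.add {σ : Set ℂ} {f g : σ → ℂ} (hf : IsPlanarAC f) (hg : IsPlanarAC g) :
    IsPlanarAC (f + g) := by
  obtain ⟨f, hf, rfl⟩ := hf
  obtain ⟨g, hg, rfl⟩ := hg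
  exact ⟨f + g, add_mem hf hg, map_add _ _ _⟩

theorem IsPlanarAC.smul {σ : Set ℂ} (c : ℂ) {f : σ → ℂ} (hf : IsPlanarAC f) :
    IsPlanarAC (c • f) := by
  obtain ⟨f, hf, rfl⟩ := hf
  exact ⟨c • f, (AC σ).smul_mem hf c, map_smul _ _ _⟩

theorem IsPlanarAC.sum {ι : Type*} {σ : Set ℂ} (s : Finset ι) {f : ι → σ → ℂ}
    (hf : ∀ i ∈ s, IsPlanarAC (f i)) : IsPlanarAC (∑ i ∈ s, f i) := by
  classical
  induction s using Finset.induction_on with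
  | empty => exact isPlanarAC_const (σ := σ) 0
  | insert a s ha ih =>
    rw [Finset.sum_insert ha]
    exact (hf a (by simp)).add (ih fun i hi => hf i (by simp [hi]))

theorem isPlanarAC_of_mem_polySubalgebra {σ : Set ℂ} (hσ : Bornology.IsBounded σ) {f : σ → ℂ}
    (hf : f ∈ polySubalgebra σ) : IsPlanarAC f :=
  ⟨BV.mk f (polySubalgebra_le_bvSubalgebra hσ hf),
    Subalgebra.le_topologicalClosure ((polySubalgebra σ).comap (BV.val σ)) hf, rfl⟩

-- `AC σ` is closed in the variation norm; `A` and `B` bound the uniform part and the variation part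
-- of the distance separately.
open Filter Topology in
theorem IsPlanarAC.of_tendsto {σ : Set ℂ} {g : ℕ → σ → ℂ} {f : σ → ℂ} {A B : ℕ → ℝ}
    (hg : ∀ n, IsPlanarAC (g n)) (hA0 : ∀ n, 0 ≤ A n) (hB0 : ∀ n, 0 ≤ B n)
    (hA : ∀ n z, ‖f z - g n z‖ ≤ A n)
    (hB : ∀ n, planarVariation (f - g n) ≤ ENNReal.ofReal (B n)) (hAB : Tendsto (A + B) atTop (𝓝 0)) :
    IsPlanarAC f := by
  have hd : ∀ n, HasBoundedPlanarVariation (f - g n) := fun n => .of_le (hA n) (hB n)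
  have hf : HasBoundedPlanarVariation f := by
    simpa using (hd 0).add (hg 0).hasBoundedPlanarVariation
  refine ⟨BV.mk f hf, ?_, rfl⟩
  have hcl : IsClosed (AC σ : Set (BV σ)) := Subalgebra.isClosed_topologicalClosure _
  refine hcl.mem_of_tendsto (b := atTop) (f := fun n => BV.mk (g n) (hg n).hasBoundedPlanarVariation)
    ?_ (Eventually.of_forall fun n => (hg n).mk_mem)
  rw [tendsto_iff_norm_sub_tendsto_zero]
  refine squeeze_zero (fun _ => norm_nonneg _) (fun n => ?_) hAB
  rw [norm_sub_rev, BV.norm_def, map_sub]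
  exact bvNorm_le_of_le (hA0 n) (hB0 n) (hA n) (hB n)

-- The variation norm dominates the uniform norm, so `f` is a uniform limit of polynomials.
open Filter Topology in
theorem IsPlanarAC.continuous {σ : Set ℂ} {f : σ → ℂ} (hf : IsPlanarAC f) : Continuous f := by
  obtain ⟨f, hf, rfl⟩ := hf
  refine continuous_of_uniform_approx_of_continuous fun u hu => ?_
  obtain ⟨ε, hε, hu⟩ := Metric.mem_uniformity_dist.1 hu
  have hf' : f ∈ closure (((polySubalgebra σ).comap (BV.val σ) : Subalgebra ℂ (BV σ)) : Set (BV σ)) := hf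
  obtain ⟨g, hg, hfg⟩ := Metric.mem_closure_iff.1 hf' ε hε
  refine ⟨BV.val σ g, ?_, fun z => hu ?_⟩
  · have hg' : BV.val σ g ∈ polySubalgebra σ := hg
    have hle : polySubalgebra σ ≤ continuousSubalgebra := by
      rw [polySubalgebra, ← Algebra.adjoin_range_eq_range_aeval, Algebra.adjoin_le_iff]
      rintro _ ⟨i, rfl⟩
      change Continuous _
      fin_cases i
      · exact Complex.continuous_ofReal.comp (Complex.continuous_re.comp continuous_subtype_val)
      · exact Complex.continuous_ofReal.comp (Complex.continuous_im.comp continuous_subtype_val)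
    exact hle hg'
  · rw [dist_eq_norm] at hfg ⊢
    refine lt_of_le_of_lt ?_ hfg
    have := BV.norm_apply_le (f - g) z
    rwa [map_sub] at this

/-! ### Indicators of isolated points -/

open Classical in
/-- The indicator function of a point. -/
noncomputable def pointIndicator {α : Type*} (p : α) : α → ℂ := Pi.single p 1

@[simp] theorem pointIndicator_self {α : Type*} (p : α) : pointIndicator p p = 1 := by
  simp [pointIndicator]

theorem pointIndicator_of_ne {α : Type*} {p z : α} (h : z ≠ p) : pointIndicator p z = 0 := by
  simp [pointIndicator, h]

open Filter Topology in
/-- The indicator function of an isolated point of a compact set is absolutely continuous. -/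
theorem isPlanarAC_pointIndicator {σ : Set ℂ} (hσ : Bornology.IsBounded σ) (p : σ) {d : ℝ} (hd : 0 < d)
    (hp : ∀ z : σ, z ≠ p → d ≤ dist (z : ℂ) p) : IsPlanarAC (pointIndicator p) := by
  obtain ⟨R, hR⟩ := Metric.isBounded_iff.1 hσ
  obtain ⟨r, hr, hRr, hdr⟩ : ∃ r : ℝ, 0 < r ∧ R ≤ r ∧ d ≤ r :=
    ⟨max R d, lt_max_of_lt_right hd, le_max_left _ _, le_max_right _ _⟩
  -- A polynomial peaking at `p`: it is `1` there and lies in `[0, ρ]` with `ρ < 1` elsewhere on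
  -- `σ`. The choice `r ≥ R` makes it nonnegative, and `r ≥ d` makes `ρ` nonnegative. Its powers
  -- converge to the indicator of `p`.
  let w : σ → ℝ := fun z => 1 - (dist (z : ℂ) p / r) ^ 2
  let ρ : ℝ := 1 - (d / r) ^ 2
  have hρ0 : 0 ≤ ρ := sub_nonneg.2 (pow_le_one₀ (by positivity) ((div_le_one hr).2 hdr))
  have hρ1 : ρ < 1 := sub_lt_self _ (by positivity)
  have hwp : w p = 1 := by simp [w]
  have hw0 : ∀ z, 0 ≤ w z := fun z => sub_nonneg.2 (pow_le_one₀ (by positivity)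
    ((div_le_one hr).2 ((hR z.2 p.2).trans hRr)))
  have hwρ : ∀ z, z ≠ p → w z ≤ ρ := fun z hz => by
    have := hp z hz
    simp only [w, ρ]
    gcongr
  let g : σ → ℂ := fun z => (w z : ℂ)
  have hpoly : g ∈ polySubalgebra σ := by
    have hX : (fun z : σ => (((z : ℂ).re : ℝ) : ℂ)) ∈ polySubalgebra σ := ⟨MvPolynomial.X 0, by simp⟩
    have hY : (fun z : σ => (((z : ℂ).im : ℝ) : ℂ)) ∈ polySubalgebra σ := ⟨MvPolynomial.X 1, by simp⟩
    have h := sub_mem (one_mem (polySubalgebra σ)) (Subalgebra.smul_mem _ (add_mem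
      (pow_mem (sub_mem hX (Subalgebra.algebraMap_mem _ ((p : ℂ).re : ℂ))) 2)
      (pow_mem (sub_mem hY (Subalgebra.algebraMap_mem _ ((p : ℂ).im : ℂ))) 2)) ((1 / r ^ 2 : ℝ) : ℂ))
    convert h using 1
    funext z
    simp only [g, w, div_pow, dist_eq_norm, Complex.sq_norm, Complex.normSq_apply, Complex.sub_re,
      Complex.sub_im, Pi.sub_apply, Pi.smul_apply, Pi.add_apply, Pi.pow_apply, Pi.one_apply,
      Pi.algebraMap_apply, Algebra.algebraMap_self_apply, smul_eq_mul]
    push_cast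
    ring
  have hgAC := isPlanarAC_of_mem_polySubalgebra hσ hpoly
  let V := (planarVariation g).toReal
  -- The error of the `n`-th power is a `κ n`-Lipschitz function of `g`. The first summand handles
  -- two points other than `p`, via `|a ^ n - b ^ n|`; the second handles a pair containing `p`,
  -- where `w ^ n ≤ ρ ^ n` while `w` differs from `1` by at least `1 - ρ`. Since `κ n` tends to `0`,
  -- so does the variation of the error.
  let κ : ℕ → ℝ := fun n => n * ρ ^ (n - 1) + ρ ^ n / (1 - ρ)
  have hκ0 : ∀ n, 0 ≤ κ n := fun n =>
    add_nonneg (by positivity) (div_nonneg (by positivity) (sub_pos.2 hρ1).le)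
  have hlip : ∀ n, ∀ x y : σ, ‖(pointIndicator p - g ^ n : σ → ℂ) x -
      (pointIndicator p - g ^ n : σ → ℂ) y‖ ≤ κ n * ‖g x - g y‖ := by
    intro n
    have hκ1 : ρ ^ n ≤ κ n * (1 - ρ) := by
      have : ρ ^ n / (1 - ρ) * (1 - ρ) = ρ ^ n := div_mul_cancel₀ _ (sub_pos.2 hρ1).ne'
      have h2 : 0 ≤ n * ρ ^ (n - 1) * (1 - ρ) := mul_nonneg (by positivity) (sub_pos.2 hρ1).le
      simp only [κ]
      linarith
    have key : ∀ y, y ≠ p → w y ^ n ≤ κ n * (1 - w y) := fun y hy =>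
      (pow_le_pow_left₀ (hw0 y) (hwρ y hy) n).trans (hκ1.trans
        (mul_le_mul_of_nonneg_left (by linarith [hwρ y hy]) (hκ0 n)))
    intro x y
    have hgn : ∀ z, (g ^ n : σ → ℂ) z = ((w z ^ n : ℝ) : ℂ) := fun z => by simp [g]
    have hgs : ∀ x y, ‖g x - g y‖ = |w x - w y| := fun x y => by
      simp only [g]
      rw [← Complex.ofReal_sub, Complex.norm_real, Real.norm_eq_abs]
    simp only [Pi.sub_apply, hgn, hgs]
    by_cases hx : x = p
    · by_cases hy : y = p
      · simp [hx, hy]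
      · subst hx
        rw [pointIndicator_self, pointIndicator_of_ne hy, hwp, one_pow,
          abs_of_nonneg (by linarith [hwρ y hy])]
        simp only [Complex.ofReal_one, sub_self, zero_sub, sub_neg_eq_add, zero_add,
          Complex.norm_real, Real.norm_eq_abs, abs_of_nonneg (pow_nonneg (hw0 y) n)]
        exact key y hy
    · by_cases hy : y = p
      · subst hy
        rw [pointIndicator_self, pointIndicator_of_ne hx, hwp, one_pow, abs_sub_comm,
          abs_of_nonneg (by linarith [hwρ x hx])]
        simp only [Complex.ofReal_one, sub_self, zero_sub, sub_zero, norm_neg,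
          Complex.norm_real, Real.norm_eq_abs, abs_of_nonneg (pow_nonneg (hw0 x) n)]
        exact key x hx
      · rw [pointIndicator_of_ne hx, pointIndicator_of_ne hy, zero_sub, zero_sub, ← neg_sub', norm_neg,
          ← Complex.ofReal_sub, Complex.norm_real, Real.norm_eq_abs]
        refine (abs_pow_sub_pow_le _ _ n).trans ?_
        have hm : max |w x| |w y| ^ (n - 1) ≤ ρ ^ (n - 1) := by
          refine pow_le_pow_left₀ (by positivity) (max_le ?_ ?_) _
          · rw [abs_of_nonneg (hw0 x)]; exact hwρ x hx
          · rw [abs_of_nonneg (hw0 y)]; exact hwρ y hy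
        have hρn : 0 ≤ ρ ^ n / (1 - ρ) := div_nonneg (by positivity) (sub_pos.2 hρ1).le
        calc |w x - w y| * n * max |w x| |w y| ^ (n - 1) ≤ |w x - w y| * n * ρ ^ (n - 1) := by gcongr
          _ = n * ρ ^ (n - 1) * |w x - w y| := by ring
          _ ≤ κ n * |w x - w y| := by
            gcongr
            exact le_add_of_nonneg_right hρn
  refine IsPlanarAC.of_tendsto (g := fun n => g ^ (n + 1)) (A := fun n => ρ ^ (n + 1))
    (B := fun n => κ (n + 1) * V) (fun n => ?_) (fun n => by positivity)
    (fun n => mul_nonneg (hκ0 _) ENNReal.toReal_nonneg) (fun n z => ?_) (fun n => ?_) ?_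
  · exact isPlanarAC_of_mem_polySubalgebra hσ (pow_mem hpoly _)
  · by_cases hz : z = p
    · subst hz
      simp [g, hwp, hρ0]
    · rw [pointIndicator_of_ne hz, Pi.pow_apply, zero_sub, norm_neg, norm_pow]
      refine pow_le_pow_left₀ (norm_nonneg _) ?_ _
      simpa [g, abs_of_nonneg (hw0 z)] using hwρ z hz
  · refine (planarVariation_le_of_enorm_sub_le (K := ENNReal.ofReal (κ (n + 1))) (g := g)
      fun x y => ?_).trans (le_of_eq ?_)
    · rw [← ofReal_norm, ← ofReal_norm, ← ENNReal.ofReal_mul (hκ0 _)]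
      exact ENNReal.ofReal_le_ofReal (hlip _ x y)
    · rw [ENNReal.ofReal_mul (hκ0 _), ENNReal.ofReal_toReal hgAC.hasBoundedPlanarVariation.2]
  · have h1 := tendsto_pow_atTop_nhds_zero_of_lt_one hρ0 hρ1
    have h2 := tendsto_self_mul_const_pow_of_lt_one hρ0 hρ1
    have hA : Tendsto (fun n => ρ ^ (n + 1)) atTop (𝓝 0) := h1.comp (tendsto_add_atTop_nat 1)
    have h := hA.add (((h2.add h1).add (hA.div_const (1 - ρ))).mul_const V)
    simp only [zero_div, add_zero, zero_mul] at h
    refine h.congr fun n => ?_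
    simp only [κ, Pi.add_apply, Nat.add_sub_cancel]
    push_cast
    ring

/-! ### Separating lines and monotone lists on a ray -/

/-- Variation estimate by separating lines: if any two points at which `u` differs are strictly
separated by one of finitely many lines, or told apart by one of finitely many functions, then the
variation of `u` is bounded by the number of lines and the variations of these functions. -/
theorem planarVariation_le_of_separated {ι κ : Type*} {σ : Set ℂ} (s : Finset ι) (L : ι → PlaneLine)
    (t : Finset κ) (g : κ → σ → ℂ) {u : σ → ℂ} (h1 : ∀ x y, ‖u x - u y‖ₑ ≤ 1)
    (h : ∀ x y, u x ≠ u y → (∃ i ∈ s, (L i).form x * (L i).form y < 0) ∨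
      ∃ p ∈ t, 1 ≤ ‖g p x - g p y‖ₑ) :
    planarVariation u ≤ s.card + ∑ p ∈ t, planarVariation (g p) := by
  classical
  refine planarVariation_le_iff.2 fun n x => ?_
  set V := variationFactor n (fun i => (x i : ℂ)) with hV
  -- Each jump of `u` has size at most `1` and is charged to a line strictly crossed at that step or
  -- to a function `g p` that moves by at least `1`. Strict crossings of one line number at most the
  -- variation factor.
  have hstep : ∀ i, ‖u (x (i + 1)) - u (x i)‖ₑ ≤
      ∑ a ∈ s, (if (L a).form (x i) * (L a).form (x (i + 1)) < 0 then (1 : ℝ≥0∞) else 0) +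
        ∑ p ∈ t, ‖g p (x (i + 1)) - g p (x i)‖ₑ := fun i => by
    by_cases hu : u (x (i + 1)) = u (x i)
    · simp [hu]
    · refine (h1 _ _).trans ?_
      rcases h _ _ hu with ⟨a, ha, hneg⟩ | ⟨p, hp, hge⟩
      · refine le_add_right (le_trans ?_ (Finset.single_le_sum (fun _ _ => zero_le) ha))
        rw [if_pos (by rwa [mul_comm])]
      · exact le_add_left (hge.trans (Finset.single_le_sum
          (f := fun p => ‖g p (x (i + 1)) - g p (x i)‖ₑ) (fun _ _ => zero_le) hp))
  have hline : ∀ a, ∑ i ∈ Finset.range n,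
      (if (L a).form (x i) * (L a).form (x (i + 1)) < 0 then (1 : ℝ≥0∞) else 0) ≤ V := fun a => by
    rw [Finset.sum_boole]
    rcases Nat.eq_zero_or_pos n with h0 | h0
    · simp [h0]
    · have : ((Finset.range n).filter
          (fun i => (L a).form (x i) * (L a).form (x (i + 1)) < 0)).card ≤ V := by
        refine le_trans ?_ (crossingCount_le_variationFactor n _ (L a))
        rw [crossingCount, if_neg h0.ne']
        refine Finset.card_le_card fun i hi => ?_
        simp only [Finset.mem_filter] at hi ⊢
        exact ⟨hi.1, Or.inl hi.2⟩
      exact_mod_cast this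
  calc curveVariation u n x ≤ _ := Finset.sum_le_sum fun i _ => hstep i
    _ = ∑ a ∈ s, ∑ i ∈ Finset.range n,
          (if (L a).form (x i) * (L a).form (x (i + 1)) < 0 then (1 : ℝ≥0∞) else 0) +
        ∑ p ∈ t, curveVariation (g p) n x := by
      rw [Finset.sum_add_distrib, Finset.sum_comm, Finset.sum_comm (s := Finset.range n) (t := t)]
      rfl
    _ ≤ ∑ a ∈ s, (V : ℝ≥0∞) + ∑ p ∈ t, planarVariation (g p) * V :=
      add_le_add (Finset.sum_le_sum fun a _ => hline a)
        (Finset.sum_le_sum fun p _ => curveVariation_le _ _ _)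
    _ = _ := by rw [add_mul, Finset.sum_mul, Finset.sum_const, nsmul_eq_mul]

/-- The variation factor of a strictly monotone list on a ray is bounded. -/
theorem variationFactor_le_four {r : ℕ → ℝ} (hr : StrictAnti r) (v : ℂ) (n : ℕ) :
    variationFactor n (fun i => (r i : ℂ) * v) ≤ 4 := by
  classical
  have : Nonempty PlaneLine := ⟨⟨1, 0, 0, Or.inl one_ne_zero⟩⟩
  refine ciSup_le fun L => ?_
  unfold crossingCount
  split_ifs
  · norm_num
  · norm_num
  have hform : ∀ t : ℝ, L.form (t * v) = t * (L.a * v.re + L.b * v.im) - L.c := fun t => by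
    simp [PlaneLine.form]
    ring
  set α := L.a * v.re + L.b * v.im
  -- The form is affine in the position on the ray, so it is strictly monotone along the list or, if
  -- `α = 0`, constant. Hence there is at most one strict crossing (`A`) and at most one entry onto
  -- the line (`B`; entries need `α ≠ 0`). The end clauses add the indices `0` and `n - 1`, for a
  -- total of four.
  let A : Finset ℕ := (Finset.range n).filter
    fun i => (r i * α - L.c) * (r (i + 1) * α - L.c) < 0
  let B : Finset ℕ := (Finset.range n).filter fun i => α ≠ 0 ∧ r i * α - L.c = 0
  have hA : A.card ≤ 1 := by
    refine Finset.card_le_one.2 fun i hi j hj => ?_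
    simp only [A, Finset.mem_filter] at hi hj
    by_contra hij
    wlog hlt : i < j generalizing i j
    · exact this j i hj hi (Ne.symm hij) (by omega)
    have h1 : r j ≤ r (i + 1) := hr.antitone hlt
    have h2 : r (i + 1) < r i := hr (Nat.lt_succ_self i)
    have h3 : r (j + 1) < r j := hr (Nat.lt_succ_self j)
    rcases lt_trichotomy α 0 with h | h | h
    · have e1 : r i * α < r (i + 1) * α := mul_lt_mul_of_neg_right h2 h
      have e2 : r (i + 1) * α ≤ r j * α := mul_le_mul_of_nonpos_right h1 h.le
      have e3 : r j * α < r (j + 1) * α := mul_lt_mul_of_neg_right h3 h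
      rcases mul_neg_iff.1 hi.2 with ⟨p1, p2⟩ | ⟨p1, p2⟩ <;>
      rcases mul_neg_iff.1 hj.2 with ⟨q1, q2⟩ | ⟨q1, q2⟩ <;> linarith
    · have := hi.2
      rw [h] at this
      nlinarith [sq_nonneg L.c]
    · have e1 : r (i + 1) * α < r i * α := mul_lt_mul_of_pos_right h2 h
      have e2 : r j * α ≤ r (i + 1) * α := mul_le_mul_of_nonneg_right h1 h.le
      have e3 : r (j + 1) * α < r j * α := mul_lt_mul_of_pos_right h3 h
      rcases mul_neg_iff.1 hi.2 with ⟨p1, p2⟩ | ⟨p1, p2⟩ <;>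
      rcases mul_neg_iff.1 hj.2 with ⟨q1, q2⟩ | ⟨q1, q2⟩ <;> linarith
  have hB : B.card ≤ 1 := by
    refine Finset.card_le_one.2 fun i hi j hj => ?_
    simp only [B, Finset.mem_filter] at hi hj
    exact hr.injective (mul_right_cancel₀ hi.2.1 (by linarith [hi.2.2, hj.2.2]))
  calc _ ≤ (A ∪ B ∪ ({0} ∪ {n - 1})).card := Finset.card_le_card fun i hi => ?_
    _ ≤ (A.card + B.card) + (1 + 1) := (Finset.card_union_le _ _).trans
        (add_le_add (Finset.card_union_le _ _) (Finset.card_union_le _ _))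
    _ ≤ 4 := by omega
  simp only [Finset.mem_filter] at hi
  obtain ⟨hin, hi⟩ := hi
  simp only [IsCrossingSegment, PlaneLine.Has, hform] at hi
  simp only [Finset.mem_union, Finset.mem_singleton, A, B, Finset.mem_filter]
  rcases hi with hi | hi | hi | hi
  · exact Or.inl (Or.inl ⟨hin, hi⟩)
  · exact Or.inr (Or.inl hi.1)
  · refine Or.inl (Or.inr ⟨hin, fun h0 => hi.2.2 ?_, hi.2.1⟩)
    have := hi.2.1
    rw [h0] at this ⊢
    linarith
  · exact Or.inr (Or.inr (by omega))

/-- An infinite set of positive reals which accumulates at most at `0` can be listed in decreasing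
order. -/
theorem exists_strictAnti_range_eq {T : Set ℝ} (hinf : T.Infinite) (hpos : ∀ t ∈ T, 0 < t)
    (hfin : ∀ ε > 0, {t ∈ T | ε ≤ t}.Finite) :
    ∃ r : ℕ → ℝ, StrictAnti r ∧ Set.range r = T := by
  classical
  -- With the order reversed, `T` is locally finite, has a least element (the maximum of `T`) and no
  -- greatest one, so it is order isomorphic to `ℕ`.
  have hI : ∀ a b : (T)ᵒᵈ, (Set.Icc a b).Finite := fun a b => by
    refine Set.Finite.of_finite_image (f := fun x : (T)ᵒᵈ => ((OrderDual.ofDual x : T) : ℝ))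
      ((hfin _ (hpos _ (OrderDual.ofDual b).2)).subset ?_) (fun x _ y _ h => ?_)
    · rintro _ ⟨x, hx, rfl⟩
      exact ⟨(OrderDual.ofDual x).2, hx.2⟩
    · exact Subtype.ext h
  let : LocallyFiniteOrder (T)ᵒᵈ := LocallyFiniteOrder.ofFiniteIcc hI
  obtain ⟨t₀, ht₀⟩ := hinf.nonempty
  obtain ⟨m, hm, hmax⟩ := Set.exists_max_image _ id (hfin t₀ (hpos t₀ ht₀)) ⟨t₀, ht₀, le_rfl⟩
  let : OrderBot (T)ᵒᵈ :=
    { bot := OrderDual.toDual ⟨m, hm.1⟩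
      bot_le := fun x => by
        change ((OrderDual.ofDual x : T) : ℝ) ≤ m
        rcases le_total t₀ (OrderDual.ofDual x : T) with h | h
        · exact hmax _ ⟨(OrderDual.ofDual x).2, h⟩
        · exact h.trans hm.2 }
  have : NoMaxOrder (T)ᵒᵈ := ⟨fun a => by
    by_contra! hcon
    refine hinf ((hfin _ (hpos _ (OrderDual.ofDual a).2)).subset fun t ht => ⟨ht, ?_⟩)
    exact hcon (OrderDual.toDual ⟨t, ht⟩)⟩
  let : SuccOrder (T)ᵒᵈ := LinearLocallyFiniteOrder.succOrder _
  let : PredOrder (T)ᵒᵈ := LinearLocallyFiniteOrder.predOrder _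
  let φ : (T)ᵒᵈ ≃o ℕ := orderIsoNatOfLinearSuccPredArch
  refine ⟨fun n => ((OrderDual.ofDual (φ.symm n) : T) : ℝ), fun a b hab => ?_, ?_⟩
  · exact φ.symm.strictMono hab
  · ext t
    constructor
    · rintro ⟨n, rfl⟩
      exact (OrderDual.ofDual (φ.symm n)).2
    · intro ht
      exact ⟨φ (OrderDual.toDual ⟨t, ht⟩), by simp⟩

/-! ### Countable compact sets with the single limit point `0` -/

section CSet

variable {σ : Set ℂ}

theorem IsCSet.zero_mem (hσ : IsCSet σ) : (0 : ℂ) ∈ σ := by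
  have h := (hσ.2.2.2 0).2 rfl
  exact hσ.2.2.1.isClosed.closure_subset (mem_closure_iff_clusterPt.2 h.clusterPt)

/-- Otherwise compactness would give a limit point of norm at least `ε`, but `0` is the only one. -/
theorem IsCSet.finite_of_le_norm (hσ : IsCSet σ) {ε : ℝ} (hε : 0 < ε) :
    {z ∈ σ | ε ≤ ‖z‖}.Finite := by
  by_contra hinf
  have hK : IsCompact {z ∈ σ | ε ≤ ‖z‖} :=
    hσ.2.2.1.inter_right (isClosed_le continuous_const continuous_norm)
  obtain ⟨z, hz, hacc⟩ := Set.Infinite.exists_accPt_of_subset_isCompact hinf hK subset_rfl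
  have h0 : z = 0 := (hσ.2.2.2 z).1 (hacc.mono (Filter.principal_mono.2 fun w hw => hw.1))
  have := hz.2
  rw [h0, norm_zero] at this
  linarith

theorem IsCSet.exists_isolating (hσ : IsCSet σ) {p : σ} (hp : (p : ℂ) ≠ 0) :
    ∃ d > 0, ∀ z : σ, z ≠ p → d ≤ dist (z : ℂ) p := by
  have h : ¬ AccPt (p : ℂ) (Filter.principal σ) := fun h => hp ((hσ.2.2.2 _).1 h)
  rw [accPt_iff_frequently] at h
  simp only [Filter.not_frequently, Metric.eventually_nhds_iff] at h
  obtain ⟨d, hd, hball⟩ := h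
  refine ⟨d, hd, fun z hz => ?_⟩
  by_contra! hlt
  exact hball hlt ⟨fun he => hz (Subtype.ext he), z.2⟩

open Filter Topology in
theorem IsCSet.tendsto_of_injective (hσ : IsCSet σ) {e : ℕ → σ} (he : Function.Injective e) :
    Tendsto e atTop (𝓝 ⟨0, hσ.zero_mem⟩) := by
  rw [tendsto_subtype_rng, ← Nat.cofinite_eq_atTop, Metric.tendsto_nhds]
  intro ε hε
  have := (hσ.finite_of_le_norm hε).preimage
    (f := fun i => (e i : ℂ)) (Subtype.val_injective.comp he).injOn
  refine this.subset fun i hi => ⟨(e i).2, ?_⟩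
  simpa using hi

theorem IsCSet.isPlanarAC_pointIndicator (hσ : IsCSet σ) {p : σ} (hp : (p : ℂ) ≠ 0) :
    IsPlanarAC (pointIndicator p) := by
  obtain ⟨d, hd, h⟩ := hσ.exists_isolating hp
  exact _root_.isPlanarAC_pointIndicator hσ.2.2.1.isBounded p hd h

end CSet

/-! ### Enumerations of ray sets -/

/-- The indicator function of the first `n` terms of an (injective) sequence. -/
noncomputable def initialIndicator {α : Type*} (e : ℕ → α) (n : ℕ) : α → ℂ :=
  ∑ i ∈ Finset.range n, pointIndicator (e i)

theorem initialIndicator_apply {α : Type*} {e : ℕ → α} (he : Function.Injective e) (n i : ℕ) :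
    initialIndicator e n (e i) = if i < n then 1 else 0 := by
  classical
  simp [initialIndicator, Finset.sum_apply, pointIndicator, Pi.single_apply, he.eq_iff]

theorem initialIndicator_apply_of_forall_ne {α : Type*} {e : ℕ → α} (n : ℕ) {z : α}
    (h : ∀ i, e i ≠ z) : initialIndicator e n z = 0 := by
  classical
  rw [initialIndicator, Finset.sum_apply]
  exact Finset.sum_eq_zero fun i _ => pointIndicator_of_ne (h i).symm

/-- `e` enumerates the points of `σ` other than `0` and those in `P` by `k` sequences such that
initial segments of these have uniformly bounded indicator functions, and the variation of a
function along the sequences is bounded by its variation norm. -/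
structure RayEnumeration (k : ℕ) (σ : Set ℂ) (P : Finset σ) (e : Fin k → ℕ → σ) : Prop where
  injective : Function.Injective fun q : Fin k × ℕ => e q.1 q.2
  ne_zero : ∀ j i, (e j i : ℂ) ≠ 0
  notMem : ∀ j i, e j i ∉ P
  exists_eq : ∀ z : σ, (z : ℂ) ≠ 0 → z ∉ P → ∃ j i, e j i = z
  variation_le : ∃ C : ℝ, 0 ≤ C ∧
    ∀ j n, planarVariation (initialIndicator (e j) n) ≤ ENNReal.ofReal C
  le_norm : ∃ C : ℝ, 0 ≤ C ∧ ∀ f : σ → ℂ, HasBoundedPlanarVariation f → ∀ j n,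
    ∑ i ∈ Finset.range n, ‖f (e j (i + 1)) - f (e j i)‖ ≤ C * bvNorm f

theorem RayEnumeration.injective_apply {k : ℕ} {σ : Set ℂ} {P : Finset σ} {e : Fin k → ℕ → σ}
    (he : RayEnumeration k σ P e) (j : Fin k) : Function.Injective (e j) := fun a b h =>
  congrArg Prod.snd (he.injective (a₁ := (j, a)) (a₂ := (j, b)) h)

/-- The perpendicular bisector of `u` and `v` passes through the origin and separates the two open
rays: the inner products of `u - v` with `u` and `v` are `1 - ⟨u, v⟩ > 0` and its negative. -/
theorem form_mul_form_neg_of_norm_eq_one {u v : ℂ} (hu : ‖u‖ = 1) (hv : ‖v‖ = 1) (huv : u ≠ v) :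
    ∃ L : PlaneLine, ∀ s t : ℝ, 0 < s → 0 < t → L.form (s * u) * L.form (t * v) < 0 := by
  have hne : u.re - v.re ≠ 0 ∨ u.im - v.im ≠ 0 := by
    by_contra! h
    exact huv (Complex.ext (sub_eq_zero.1 h.1) (sub_eq_zero.1 h.2))
  refine ⟨⟨u.re - v.re, u.im - v.im, 0, hne⟩, fun s t hs ht => ?_⟩
  have hu2 : u.re ^ 2 + u.im ^ 2 = 1 := by
    have := Complex.sq_norm u
    rw [hu, Complex.normSq_apply] at this
    linarith
  have hv2 : v.re ^ 2 + v.im ^ 2 = 1 := by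
    have := Complex.sq_norm v
    rw [hv, Complex.normSq_apply] at this
    linarith
  have hpos : 0 < (u.re - v.re) ^ 2 + (u.im - v.im) ^ 2 := by
    rcases hne with h | h
    · exact add_pos_of_pos_of_nonneg (by positivity) (by positivity)
    · exact add_pos_of_nonneg_of_pos (by positivity) (by positivity)
  have hd : 0 < 1 - (u.re * v.re + u.im * v.im) := by nlinarith
  simp only [PlaneLine.form, Complex.re_ofReal_mul, Complex.im_ofReal_mul, sub_zero]
  have e1 : (u.re - v.re) * (s * u.re) + (u.im - v.im) * (s * u.im) =
      s * (1 - (u.re * v.re + u.im * v.im)) := by linear_combination s * hu2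
  have e2 : (u.re - v.re) * (t * v.re) + (u.im - v.im) * (t * v.im) =
      -(t * (1 - (u.re * v.re + u.im * v.im))) := by linear_combination (-t) * hv2
  rw [e1, e2, mul_neg, neg_lt_zero]
  positivity

/-- The line perpendicular to the unit vector `u` at distance `s` from the origin. -/
theorem exists_line_form_eq {u : ℂ} (hu : ‖u‖ = 1) (s : ℝ) :
    ∃ L : PlaneLine, ∀ t : ℝ, L.form (t * u) = t - s := by
  have hu2 : u.re ^ 2 + u.im ^ 2 = 1 := by
    have := Complex.sq_norm u
    rw [hu, Complex.normSq_apply] at this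
    linarith
  have hne : u.re ≠ 0 ∨ u.im ≠ 0 := by
    by_contra! h
    rw [h.1, h.2] at hu2
    norm_num at hu2
  refine ⟨⟨u.re, u.im, s, hne⟩, fun t => ?_⟩
  simp only [PlaneLine.form, Complex.re_ofReal_mul, Complex.im_ofReal_mul]
  linear_combination t * hu2

/-- Bounding the initial indicators is the geometric core. One line across ray `j` cuts an initial
segment off from the rest of that ray and from `0`, a line through the origin cuts it off from each
other ray, and the points of `P` are told apart by their indicators. None of these counts depends on
the length of the segment. -/
theorem rayEnumeration_of_strictAnti {k : ℕ} {σ : Set ℂ} (hσ : IsCSet σ) {u : Fin k → ℂ}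
    (hu : ∀ j, ‖u j‖ = 1) (huinj : Function.Injective u) {r : Fin k → ℕ → ℝ}
    (hr : ∀ j, StrictAnti (r j)) (hr0 : ∀ j i, 0 < r j i) {e : Fin k → ℕ → σ}
    (he : ∀ j i, (e j i : ℂ) = r j i * u j) {P : Finset σ}
    (hP : ∀ z, z ∈ P ↔ (z : ℂ) ≠ 0 ∧ ∀ j i, e j i ≠ z) : RayEnumeration k σ P e := by
  classical
  have hnorm : ∀ j i, ‖(e j i : ℂ)‖ = r j i := fun j i => by
    rw [he, norm_mul, hu, mul_one, Complex.norm_real, Real.norm_eq_abs, abs_of_pos (hr0 j i)]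
  have hinj : ∀ j i j' i', e j i = e j' i' → j = j' ∧ i = i' := fun j i j' i' h => by
    have hrr : r j i = r j' i' := by rw [← hnorm, ← hnorm, h]
    have hj : j = j' := by
      have h2 : (r j i : ℂ) * u j = r j' i' * u j' := by rw [← he, ← he, h]
      rw [hrr] at h2
      exact huinj (mul_left_cancel₀ (Complex.ofReal_ne_zero.2 (hr0 j' i').ne') h2)
    subst hj
    exact ⟨rfl, (hr j).injective hrr⟩
  refine ⟨fun a b h => Prod.ext (hinj _ _ _ _ h).1 (hinj _ _ _ _ h).2, fun j i => ?_,
    fun j i h => ((hP _).1 h).2 j i rfl, fun z hz hzP => ?_, ?_, ?_⟩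
  · rw [← norm_ne_zero_iff, hnorm]
    exact (hr0 j i).ne'
  · by_contra! hcon
    exact hzP ((hP z).2 ⟨hz, hcon⟩)
  -- One separating line for each of the `k` rays, and one indicator for each exceptional point.
  · let D : ℝ≥0∞ := k + ∑ p ∈ P, planarVariation (pointIndicator p)
    have hD : D ≠ ∞ := by
      refine ENNReal.add_ne_top.2 ⟨ENNReal.natCast_ne_top k, ENNReal.sum_ne_top.2 fun p hp => ?_⟩
      exact (hσ.isPlanarAC_pointIndicator ((hP p).1 hp).1).hasBoundedPlanarVariation.2
    refine ⟨D.toReal, ENNReal.toReal_nonneg, fun j n => ?_⟩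
    rw [ENNReal.ofReal_toReal hD]
    have hej : Function.Injective (e j) := fun a b h => (hinj _ _ _ _ h).2
    rcases Nat.eq_zero_or_pos n with h0 | h0
    · subst h0
      have : initialIndicator (e j) 0 = fun _ => 0 := by
        simp only [initialIndicator, Finset.range_zero, Finset.sum_empty]
        rfl
      rw [this, planarVariation_const]
      exact zero_le
    obtain ⟨m, rfl⟩ : ∃ m, n = m + 1 := ⟨n - 1, by omega⟩
    obtain ⟨Lp, hLp⟩ := exists_line_form_eq (hu j) ((r j m + r j (m + 1)) / 2)
    have hLex : ∀ j', ∃ L : PlaneLine, j' ≠ j → ∀ s t : ℝ, 0 < s → 0 < t →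
        L.form (s * u j) * L.form (t * u j') < 0 := fun j' => by
      by_cases hj : j' = j
      · exact ⟨Lp, fun h => absurd hj h⟩
      · obtain ⟨L, hL⟩ := form_mul_form_neg_of_norm_eq_one (hu j) (hu j') (huinj.ne (Ne.symm hj))
        exact ⟨L, fun _ => hL⟩
    choose Lo hLo using hLex
    -- Place `j` is free, since no bisector is needed there; it takes the perpendicular midway
    -- between the last included and the first excluded term.
    let L : Fin k → PlaneLine := fun j' => if j' = j then Lp else Lo j'
    have hval : ∀ z, initialIndicator (e j) (m + 1) z = 1 ∧ (∃ i ≤ m, e j i = z) ∨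
        initialIndicator (e j) (m + 1) z = 0 ∧ (∀ i ≤ m, e j i ≠ z) := fun z => by
      by_cases h : ∃ i, e j i = z
      · obtain ⟨i, rfl⟩ := h
        rw [initialIndicator_apply hej]
        by_cases hi : i < m + 1
        · exact Or.inl ⟨if_pos hi, i, by omega, rfl⟩
        · refine Or.inr ⟨if_neg hi, fun i' hi' h => ?_⟩
          have := hej h
          omega
      · push Not at h
        exact Or.inr ⟨initialIndicator_apply_of_forall_ne _ h, fun i _ => h i⟩
    have hmid1 : r j (m + 1) < (r j m + r j (m + 1)) / 2 := by linarith [hr j (Nat.lt_succ_self m)]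
    have hmid2 : (r j m + r j (m + 1)) / 2 < r j m := by linarith [hr j (Nat.lt_succ_self m)]
    have key : ∀ i ≤ m, ∀ y, (∀ i ≤ m, e j i ≠ y) →
        (∃ a ∈ Finset.univ, (L a).form (e j i) * (L a).form y < 0) ∨
        ∃ p ∈ P, 1 ≤ ‖pointIndicator p (e j i) - pointIndicator p y‖ₑ := by
      intro i hi y hy
      have hposi : 0 < r j i - (r j m + r j (m + 1)) / 2 := by linarith [(hr j).antitone hi]
      by_cases hyP : y ∈ P
      · refine Or.inr ⟨y, hyP, ?_⟩
        rw [pointIndicator_self, pointIndicator_of_ne (hy i hi)]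
        simp
      refine Or.inl ?_
      by_cases hy0 : (y : ℂ) = 0
      -- The bisectors may pass through the origin, so `0` is separated by the perpendicular line
      -- instead.
      · refine ⟨j, Finset.mem_univ _, ?_⟩
        have h0 : (y : ℂ) = (0 : ℝ) * u j := by rw [hy0]; simp
        simp only [L, if_pos]
        rw [he, h0, hLp, hLp]
        refine mul_neg_of_pos_of_neg hposi ?_
        linarith [hr0 j (m + 1)]
      · have : ∃ j' i', e j' i' = y := by
          by_contra! hcon
          exact hyP ((hP y).2 ⟨hy0, hcon⟩)
        obtain ⟨j', i', rfl⟩ := this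
        refine ⟨j', Finset.mem_univ _, ?_⟩
        by_cases hj : j' = j
        · subst hj
          simp only [L, if_pos]
          rw [he, he, hLp, hLp]
          refine mul_neg_of_pos_of_neg hposi ?_
          have hi' : m + 1 ≤ i' := by
            by_contra! hlt
            exact hy i' (by omega) rfl
          linarith [(hr j').antitone hi']
        · simp only [L, if_neg hj]
          rw [he, he]
          exact hLo j' hj _ _ (hr0 _ _) (hr0 _ _)
    have := planarVariation_le_of_separated (u := initialIndicator (e j) (m + 1)) Finset.univ L P
      pointIndicator (fun x y => ?_) (fun x y hxy => ?_)
    · simpa [D] using this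
    · rcases hval x with ⟨hx, -⟩ | ⟨hx, -⟩ <;> rcases hval y with ⟨hy, -⟩ | ⟨hy, -⟩ <;>
        simp [hx, hy]
    · rcases hval x with ⟨hx, hx'⟩ | ⟨hx, hx'⟩ <;> rcases hval y with ⟨hy, hy'⟩ | ⟨hy, hy'⟩
      · exact absurd (hx.trans hy.symm) hxy
      · obtain ⟨i, hi, rfl⟩ := hx'
        exact key i hi y hy'
      · obtain ⟨i, hi, rfl⟩ := hy'
        rcases key i hi x hx' with ⟨a, ha, h⟩ | ⟨p, hp, h⟩
        · exact Or.inl ⟨a, ha, by rwa [mul_comm]⟩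
        · exact Or.inr ⟨p, hp, by rwa [← enorm_neg, neg_sub]⟩
      · exact absurd (hx.trans hy.symm) hxy
  · refine ⟨4, by norm_num, fun f hf j n => ?_⟩
    have h := curveVariation_le f n (e j)
    have hvf : variationFactor n (fun i => (e j i : ℂ)) ≤ 4 := by
      simp only [he]
      exact variationFactor_le_four (hr j) _ n
    have h2 : curveVariation f n (e j) ≤ ENNReal.ofReal (4 * (planarVariation f).toReal) := by
      refine h.trans ?_
      rw [ENNReal.ofReal_mul (by norm_num), ENNReal.ofReal_toReal hf.2, mul_comm]
      gcongr
      rw [show ENNReal.ofReal 4 = ((4 : ℕ) : ℝ≥0∞) by simp]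
      exact_mod_cast hvf
    have h3 := ENNReal.toReal_mono ENNReal.ofReal_ne_top h2
    rw [ENNReal.toReal_ofReal (mul_nonneg (by norm_num) ENNReal.toReal_nonneg), curveVariation,
      ENNReal.toReal_sum (fun _ _ => enorm_ne_top)] at h3
    simp only [toReal_enorm] at h3
    refine h3.trans (mul_le_mul_of_nonneg_left ?_ (by norm_num))
    exact le_add_of_nonneg_left (iSup_norm_nonneg f)

open Classical in
/-- A further point may be put at the beginning of one of the sequences. -/
theorem RayEnumeration.exists_cons {k : ℕ} {σ : Set ℂ} (hσ : IsCSet σ) {P : Finset σ} {p : σ}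
    (hpP : p ∉ P) (hp0 : (p : ℂ) ≠ 0) {e : Fin k → ℕ → σ} (hk : 0 < k)
    (he : RayEnumeration k σ (insert p P) e) : ∃ e', RayEnumeration k σ P e' := by
  let j₀ : Fin k := ⟨0, hk⟩
  let c : ℕ → σ := fun n => Nat.casesOn n p (e j₀)
  have hc0 : c 0 = p := rfl
  have hcs : ∀ n, c (n + 1) = e j₀ n := fun n => rfl
  let e' : Fin k → ℕ → σ := Function.update e j₀ c
  have hj₀ : e' j₀ = c := Function.update_self ..
  have hj : ∀ j, j ≠ j₀ → e' j = e j := fun j h => Function.update_of_ne h ..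
  have hep : ∀ j i, e j i ≠ p := fun j i h => he.notMem j i (by simp [h])
  have hall : ∀ (Q : σ → Prop), Q p → (∀ j i, Q (e j i)) → ∀ j i, Q (e' j i) := by
    intro Q h0 h1 j i
    by_cases h : j = j₀
    · subst h
      rw [hj₀]
      cases i with
      | zero => exact h0
      | succ i => exact h1 _ i
    · rw [hj j h]
      exact h1 j i
  obtain ⟨C, hC0, hC⟩ := he.variation_le
  obtain ⟨D, hD0, hD⟩ := he.le_norm
  refine ⟨e', ?_, ?_, ?_, ?_, ?_, ?_⟩
  · rintro ⟨j, i⟩ ⟨j', i'⟩ h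
    have hee : ∀ {j i j' i'}, e j i = e j' i' → j = j' ∧ i = i' := fun {j i j' i'} h =>
      Prod.ext_iff.1 (he.injective (a₁ := (j, i)) (a₂ := (j', i')) h)
    simp only at h
    by_cases h1 : j = j₀ <;> by_cases h2 : j' = j₀
    · subst h1 h2
      rw [hj₀] at h
      cases i <;> cases i'
      · rfl
      · exact absurd h.symm (hep _ _)
      · exact absurd h (hep _ _)
      · rw [(hee h).2]
    · subst h1
      rw [hj₀, hj _ h2] at h
      cases i
      · exact absurd h.symm (hep _ _)
      · exact absurd (hee h).1.symm h2
    · subst h2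
      rw [hj₀, hj _ h1] at h
      cases i'
      · exact absurd h (hep _ _)
      · exact absurd (hee h).1 h1
    · rw [hj _ h1, hj _ h2] at h
      rw [(hee h).1, (hee h).2]
  · exact hall (fun z => (z : ℂ) ≠ 0) hp0 he.ne_zero
  · exact hall (fun z => z ∉ P) hpP fun j i h => he.notMem j i (Finset.mem_insert_of_mem h)
  · intro z hz hzP
    by_cases hzp : z = p
    · exact ⟨j₀, 0, by rw [hj₀, hc0, hzp]⟩
    · obtain ⟨j, i, rfl⟩ := he.exists_eq z hz (by simp [hzp, hzP])
      by_cases h : j = j₀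
      · exact ⟨j₀, i + 1, by rw [hj₀, h]⟩
      · exact ⟨j, i, by rw [hj _ h]⟩
  · have hpv := (hσ.isPlanarAC_pointIndicator hp0).hasBoundedPlanarVariation.2
    refine ⟨(planarVariation (pointIndicator p)).toReal + C,
      add_nonneg ENNReal.toReal_nonneg hC0, fun j n => ?_⟩
    rw [ENNReal.ofReal_add ENNReal.toReal_nonneg hC0, ENNReal.ofReal_toReal hpv]
    by_cases h : j = j₀
    · subst h
      rw [hj₀]
      cases n with
      | zero => exact le_trans (le_trans (le_of_eq rfl) (hC j₀ 0)) le_add_self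
      | succ n =>
        have : initialIndicator c (n + 1) = pointIndicator p + initialIndicator (e j₀) n := by
          rw [initialIndicator, Finset.sum_range_succ', add_comm]
          rfl
        rw [this]
        exact (planarVariation_add_le _ _).trans (by gcongr; exact hC _ _)
    · rw [hj _ h]
      exact (hC j n).trans le_add_self
  -- The `2` pays for the one new step, from `p` to the former first term.
  · refine ⟨2 + D, by positivity, fun f hf j n => ?_⟩
    have hN := bvNorm_nonneg f
    by_cases h : j = j₀
    · subst h
      rw [hj₀]
      cases n with
      | zero => simpa using mul_nonneg (by positivity) hN
      | succ n =>
        rw [Finset.sum_range_succ', add_comm, add_mul]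
        refine add_le_add ?_ (hD f hf _ n)
        refine (norm_sub_le _ _).trans ?_
        linarith [hf.norm_le_bvNorm (c 0), hf.norm_le_bvNorm (c (0 + 1))]
    · rw [hj _ h]
      refine (hD f hf j n).trans ?_
      nlinarith

theorem RayEnumeration.exists_empty {k : ℕ} {σ : Set ℂ} (hσ : IsCSet σ) (hk : 0 < k)
    {P : Finset σ} (hP : ∀ p ∈ P, (p : ℂ) ≠ 0) {e : Fin k → ℕ → σ} (he : RayEnumeration k σ P e) :
    ∃ e', RayEnumeration k σ ∅ e' := by
  classical
  induction P using Finset.induction_on generalizing e with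
  | empty => exact ⟨e, he⟩
  | insert p P hp ih =>
    obtain ⟨e', he'⟩ := he.exists_cons hσ hp (hP p (by simp)) hk
    exact ih (fun q hq => hP q (by simp [hq])) he'

theorem exp_mul_I_injOn : Set.InjOn (fun θ : ℝ => Complex.exp (θ * Complex.I))
    (Set.Ico 0 (2 * Real.pi)) := by
  intro a ha b hb h
  obtain ⟨n, hn⟩ := Complex.exp_eq_exp_iff_exists_int.1 h
  have hab : a = b + n * (2 * Real.pi) := by
    have h2 : ((a : ℂ)) * Complex.I = (b + n * (2 * Real.pi)) * Complex.I := by rw [hn]; ring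
    exact_mod_cast mul_right_cancel₀ Complex.I_ne_zero h2
  have hpi := Real.two_pi_pos
  have h1 : (n : ℝ) < 1 := by
    by_contra! hc
    nlinarith [ha.2, hb.1]
  have h2 : (-1 : ℝ) < n := by
    by_contra! hc
    nlinarith [ha.1, hb.2]
  have : n = 0 := by
    have h1' : n < 1 := by exact_mod_cast h1
    have h2' : -1 < n := by exact_mod_cast h2
    omega
  rw [hab, this]
  simp

/-- The positive parameters of the points on one ray accumulate only at `0`, so they can be listed
decreasingly. The nonzero points left over are finite in number and are absorbed by
`RayEnumeration.exists_empty`. -/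
theorem IsRaySet.exists_rayEnumeration {k : ℕ} {σ : Set ℂ} (hσ : IsRaySet k σ) :
    ∃ e, RayEnumeration k σ ∅ e := by
  classical
  obtain ⟨hC, hk, θ, hθ, hθI, hinf, hfin⟩ := hσ
  let u : Fin k → ℂ := fun j => Complex.exp (θ j * Complex.I)
  have hu : ∀ j, ‖u j‖ = 1 := fun j => Complex.norm_exp_ofReal_mul_I _
  have huinj : Function.Injective u := fun a b h => hθ (exp_mul_I_injOn (hθI a) (hθI b) h)
  have hu0 : ∀ j, u j ≠ 0 := fun j => Complex.exp_ne_zero _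
  have hnorm : ∀ j (t : ℝ), 0 < t → ‖(t : ℂ) * u j‖ = t := fun j t ht => by
    rw [norm_mul, hu, mul_one, Complex.norm_real, Real.norm_eq_abs, abs_of_pos ht]
  have hex : ∀ j, ∃ r : ℕ → ℝ, StrictAnti r ∧ Set.range r = {t : ℝ | 0 < t ∧ (t : ℂ) * u j ∈ σ} := by
    intro j
    refine exists_strictAnti_range_eq (fun hf => hinf j ?_) (fun t ht => ht.1) fun ε hε => ?_
    · refine ((hf.image fun t : ℝ => (t : ℂ) * u j).insert 0).subset ?_
      rintro _ ⟨hz, t, ht, rfl⟩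
      rcases ht.eq_or_lt with h | h
      · left
        rw [← h]
        simp
      · exact Or.inr ⟨t, ⟨h, hz⟩, rfl⟩
    · refine Set.Finite.of_finite_image (f := fun t : ℝ => (t : ℂ) * u j)
        ((hC.finite_of_le_norm hε).subset ?_) fun s _ t _ h =>
        Complex.ofReal_injective (mul_right_cancel₀ (hu0 j) h)
      rintro _ ⟨t, ht, rfl⟩
      exact ⟨ht.1.2, by rw [hnorm j t ht.1.1]; exact ht.2⟩
  choose r hr hrange using hex
  have hmem : ∀ j i, 0 < r j i ∧ (r j i : ℂ) * u j ∈ σ := fun j i => by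
    have : r j i ∈ Set.range (r j) := ⟨i, rfl⟩
    rwa [hrange] at this
  let e : Fin k → ℕ → σ := fun j i => ⟨r j i * u j, (hmem j i).2⟩
  have hPfin : {z : σ | (z : ℂ) ≠ 0 ∧ ∀ j i, e j i ≠ z}.Finite := by
    refine Set.Finite.of_finite_image (f := Subtype.val) (hfin.subset ?_)
      Subtype.val_injective.injOn
    rintro _ ⟨z, hz, rfl⟩
    refine ⟨z.2, fun hmemU => ?_⟩
    obtain ⟨j, -, t, ht, hzt⟩ := Set.mem_iUnion.1 hmemU
    rcases ht.eq_or_lt with h | h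
    · exact hz.1 (by rw [hzt, ← h]; simp)
    · have : t ∈ Set.range (r j) := by
        rw [hrange]
        exact ⟨h, by have := z.2; rwa [hzt] at this⟩
      obtain ⟨i, hi⟩ := this
      exact hz.2 j i (Subtype.ext (by rw [hzt, ← hi]))
  have := rayEnumeration_of_strictAnti hC hu huinj hr (fun j i => (hmem j i).1) (e := e)
    (fun j i => rfl) (P := hPfin.toFinset) (fun z => by simp)
  exact this.exists_empty hC hk fun p hp => by simpa using ((hPfin.mem_toFinset).1 hp).1

/-! ### Abel summation along the sequences -/

section

open Filter Topology

variable {k : ℕ} {σ τ : Set ℂ} {e : Fin k → ℕ → σ} {e' : Fin k → ℕ → τ}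

theorem IsPlanarAC.tendsto_apply {f : σ → ℂ} (hf : IsPlanarAC f) (hσ : IsCSet σ) {e : ℕ → σ}
    (he : Function.Injective e) : Tendsto (fun i => f (e i)) atTop (𝓝 (f ⟨0, hσ.zero_mem⟩)) :=
  (hf.continuous.tendsto _).comp (hσ.tendsto_of_injective he)

theorem norm_initialIndicator_le_one {α : Type*} {e : ℕ → α} (he : Function.Injective e) (n : ℕ)
    (z : α) : ‖initialIndicator e n z‖ ≤ 1 := by
  by_cases h : ∃ i, e i = z
  · obtain ⟨i, rfl⟩ := h
    rw [initialIndicator_apply he]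
    split_ifs <;> simp
  · push Not at h
    rw [initialIndicator_apply_of_forall_ne _ h]
    simp

/-- The function which agrees up to constants with `g` on the first `N` terms of each of the
sequences `e j`, and is constant elsewhere. -/
noncomputable def stepApprox (e : Fin k → ℕ → σ) (g : σ → ℂ) (c : ℂ) (N : ℕ) : σ → ℂ :=
  (fun _ => c) + ∑ j, ∑ i ∈ Finset.range N,
    (g (e j i) - g (e j (i + 1))) • initialIndicator (e j) (i + 1)

theorem stepApprox_apply_of_forall_ne (g : σ → ℂ) (c : ℂ) (N : ℕ) {z : σ}
    (hz : ∀ j i, e j i ≠ z) : stepApprox e g c N z = c := by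
  simp only [stepApprox, Pi.add_apply, Finset.sum_apply, Pi.smul_apply]
  rw [Finset.sum_eq_zero fun j _ => Finset.sum_eq_zero fun i _ => ?_, add_zero]
  rw [initialIndicator_apply_of_forall_ne _ (hz j), smul_zero]

/-- At `e j m` the indicator of the first `i + 1` terms is `1` exactly when `m ≤ i`, so the sum
telescopes from `m` to `N`; the other sequences contribute nothing. -/
theorem stepApprox_apply (he : Function.Injective fun q : Fin k × ℕ => e q.1 q.2) (g : σ → ℂ)
    (c : ℂ) {N m : ℕ} (hm : m ≤ N) (j : Fin k) :
    stepApprox e g c N (e j m) = c + (g (e j m) - g (e j N)) := by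
  have hinj : Function.Injective (e j) := fun a b h =>
    congrArg Prod.snd (he (a₁ := (j, a)) (a₂ := (j, b)) h)
  simp only [stepApprox, Pi.add_apply, Finset.sum_apply, Pi.smul_apply]
  rw [Finset.sum_eq_single j]
  · simp only [initialIndicator_apply hinj]
    congr 1
    induction N, hm using Nat.le_induction with
    | base =>
      rw [sub_self]
      refine Finset.sum_eq_zero fun i hi => ?_
      rw [if_neg (by have := Finset.mem_range.1 hi; omega), smul_zero]
    | succ N hN ih =>
      rw [Finset.sum_range_succ, ih, if_pos (by omega)]
      simp
  · intro j' _ hj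
    refine Finset.sum_eq_zero fun i _ => ?_
    rw [initialIndicator_apply_of_forall_ne _ fun i' h => hj (congrArg Prod.fst
      (he (a₁ := (j', i')) (a₂ := (j, m)) h)), smul_zero]
  · simp

theorem IsPlanarAC.initialIndicator {P : Finset σ} (hσ : IsCSet σ) (he : RayEnumeration k σ P e)
    (j : Fin k) (n : ℕ) : IsPlanarAC (initialIndicator (e j) n) :=
  .sum _ fun i _ => hσ.isPlanarAC_pointIndicator (he.ne_zero j i)

/-- A function whose variation along the sequences of a ray enumeration is finite, and which is
continuous at the origin along them, is absolutely continuous. -/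
theorem RayEnumeration.isPlanarAC_of_sum_le (hσ : IsCSet σ) (he : RayEnumeration k σ ∅ e) {C : ℝ}
    (hC0 : 0 ≤ C) (hC : ∀ j n, planarVariation (initialIndicator (e j) n) ≤ ENNReal.ofReal C)
    {g : σ → ℂ} (hlim : ∀ j, Tendsto (fun i => g (e j i)) atTop (𝓝 (g ⟨0, hσ.zero_mem⟩)))
    {A : ℝ} (hA : ∀ j n, ∑ i ∈ Finset.range n, ‖g (e j (i + 1)) - g (e j i)‖ ≤ A) :
    IsPlanarAC g ∧ planarVariation g ≤ ENNReal.ofReal (C * (k * A)) := by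
  set g0 := g ⟨0, hσ.zero_mem⟩ with hg0
  let a : Fin k → ℕ → ℝ := fun j i => ‖g (e j (i + 1)) - g (e j i)‖
  have ha0 : ∀ j i, 0 ≤ a j i := fun j i => norm_nonneg _
  have hsum : ∀ j, Summable (a j) := fun j => summable_of_sum_range_le (ha0 j) (hA j)
  -- The total tail of the variations along the sequences. It controls the uniform distance from `G
  -- N` to `g` and, up to the factor `C`, the variation of the difference.
  let t : ℕ → ℝ := fun N => ∑ j, (∑' i, a j i - ∑ i ∈ Finset.range N, a j i)
  have ht0 : ∀ N, 0 ≤ t N := fun N => Finset.sum_nonneg fun j _ =>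
    sub_nonneg.2 ((hsum j).sum_le_tsum _ fun i _ => ha0 j i)
  have htlim : Tendsto t atTop (𝓝 0) := by
    have : Tendsto t atTop (𝓝 (∑ j : Fin k, (0 : ℝ))) := tendsto_finsetSum _ fun j _ => by
      simpa using (tendsto_const_nhds (x := ∑' i, a j i)).sub (hsum j).hasSum.tendsto_sum_nat
    simpa using this
  have hAt : t 0 ≤ k * A := by
    have : t 0 ≤ ∑ j : Fin k, A := Finset.sum_le_sum fun j _ => by
      simpa using (hsum j).tsum_le_of_sum_range_le (hA j)
    simpa using this
  let G := stepApprox e g g0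
  have hGlim : ∀ z, Tendsto (fun N => G N z) atTop (𝓝 (g z)) := fun z => by
    by_cases hz : (z : ℂ) = 0
    · have hz' : z = ⟨0, hσ.zero_mem⟩ := Subtype.ext hz
      have : ∀ N, G N z = g z := fun N => by
        rw [hz']
        exact stepApprox_apply_of_forall_ne _ _ _ fun j i h => he.ne_zero j i (by rw [h])
      simp only [this]
      exact tendsto_const_nhds
    · obtain ⟨j, m, rfl⟩ := he.exists_eq z hz (by simp)
      have h1 : Tendsto (fun N => g0 + (g (e j m) - g (e j N))) atTop
          (𝓝 (g0 + (g (e j m) - g0))) := ((hlim j).const_sub _).const_add _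
      rw [add_sub_cancel] at h1
      refine h1.congr' ?_
      filter_upwards [eventually_ge_atTop m] with N hN
      exact (stepApprox_apply he.injective _ _ hN j).symm
  have hdiff : ∀ N M, N ≤ M → G M - G N = ∑ j, ∑ i ∈ Finset.Ico N M,
      (g (e j i) - g (e j (i + 1))) • initialIndicator (e j) (i + 1) := fun N M h => by
    simp only [G, stepApprox]
    rw [add_sub_add_left_eq_sub, ← Finset.sum_sub_distrib]
    exact Finset.sum_congr rfl fun j _ => (Finset.sum_Ico_eq_sub _ h).symm
  have htail : ∀ N M, N ≤ M → ∑ j, ∑ i ∈ Finset.Ico N M, a j i ≤ t N := fun N M h =>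
    Finset.sum_le_sum fun j _ => by
      rw [Finset.sum_Ico_eq_sub _ h]
      exact sub_le_sub_right ((hsum j).sum_le_tsum _ fun i _ => ha0 j i) _
  have hnormM : ∀ N M, N ≤ M → ∀ z, ‖G M z - G N z‖ ≤ t N := fun N M h z => by
    rw [← Pi.sub_apply, hdiff N M h, Finset.sum_apply]
    refine le_trans (norm_sum_le_of_le _ fun j _ => ?_) (htail N M h)
    rw [Finset.sum_apply]
    refine norm_sum_le_of_le _ fun i _ => ?_
    rw [Pi.smul_apply, norm_smul, norm_sub_rev]
    exact mul_le_of_le_one_right (ha0 j i) (norm_initialIndicator_le_one (he.injective_apply j) _ _)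
  have hvarM : ∀ N M, N ≤ M → planarVariation (G M - G N) ≤ ENNReal.ofReal (C * t N) :=
    fun N M h => by
    have hle : ENNReal.ofReal (C * ∑ j, ∑ i ∈ Finset.Ico N M, a j i) ≤ ENNReal.ofReal (C * t N) :=
      ENNReal.ofReal_le_ofReal (mul_le_mul_of_nonneg_left (htail N M h) hC0)
    refine le_trans ?_ hle
    rw [hdiff N M h, ENNReal.ofReal_mul hC0,
      ENNReal.ofReal_sum_of_nonneg fun j _ => Finset.sum_nonneg fun i _ => ha0 j i, Finset.mul_sum]
    refine (planarVariation_sum_le _ _).trans (Finset.sum_le_sum fun j _ => ?_)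
    rw [ENNReal.ofReal_sum_of_nonneg fun i _ => ha0 j i, Finset.mul_sum]
    refine (planarVariation_sum_le _ _).trans (Finset.sum_le_sum fun i _ => ?_)
    refine (planarVariation_smul_le _ _).trans ?_
    rw [mul_comm, ← enorm_neg, neg_sub, ← ofReal_norm]
    gcongr
    exact hC _ _
  have hnorm : ∀ N z, ‖g z - G N z‖ ≤ t N := fun N z =>
    le_of_tendsto ((hGlim z).sub_const _).norm
      ((eventually_ge_atTop N).mono fun M hM => hnormM N M hM z)
  -- Lower semicontinuity transfers the bound for `G M - G N` to the limit in `M`.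
  have hvar : ∀ N, planarVariation (g - G N) ≤ ENNReal.ofReal (C * t N) := fun N =>
    planarVariation_le_of_tendsto (g := fun M => G M - G N) (fun z => (hGlim z).sub_const _)
      ((eventually_ge_atTop N).mono fun M hM => hvarM N M hM)
  refine ⟨IsPlanarAC.of_tendsto (g := G) (fun N => (isPlanarAC_const _).add (.sum _ fun j _ =>
    .sum _ fun i _ => .smul _ (.initialIndicator hσ he j _))) ht0 (fun N => mul_nonneg hC0 (ht0 N))
    hnorm hvar (by simpa [Pi.add_def] using htlim.add (htlim.const_mul C)), ?_⟩
  -- `G 0` is constant, so the case `N = 0` of the tail estimate bounds the variation of `g` itself.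
  have h := planarVariation_add_le (g - G 0) (G 0)
  have hG0 : planarVariation (G 0) = 0 := by
    have : G 0 = fun _ => g0 := by
      simp only [G, stepApprox, Finset.range_zero, Finset.sum_empty, Finset.sum_const_zero, add_zero]
    rw [this, planarVariation_const]
  rw [sub_add_cancel, hG0, add_zero] at h
  exact h.trans ((hvar 0).trans (ENNReal.ofReal_le_ofReal (mul_le_mul_of_nonneg_left hAt hC0)))

theorem RayEnumeration.exists_map (hσ : IsCSet σ) (e : Fin k → ℕ → σ)
    (he' : RayEnumeration k τ ∅ e') : ∃ h : τ → σ, (∀ j i, h (e' j i) = e j i) ∧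
      ∀ z : τ, (z : ℂ) = 0 → h z = ⟨0, hσ.zero_mem⟩ := by
  classical
  have hex : ∀ z : τ, ∃ w : σ, (∀ j i, e' j i = z → w = e j i) ∧
      ((z : ℂ) = 0 → w = ⟨0, hσ.zero_mem⟩) := fun z => by
    by_cases hz : (z : ℂ) = 0
    · exact ⟨_, fun j i h => absurd (by rw [h, hz]) (he'.ne_zero j i), fun _ => rfl⟩
    · obtain ⟨j, i, rfl⟩ := he'.exists_eq z hz (by simp)
      refine ⟨e j i, fun j' i' h => ?_, fun h => absurd h hz⟩
      have := he'.injective (a₁ := (j', i')) (a₂ := (j, i)) h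
      rw [Prod.mk.injEq] at this
      rw [this.1, this.2]
  choose h h1 h2 using hex
  exact ⟨h, fun j i => h1 _ j i rfl, h2⟩

/-- Along `e' j` the function `f ∘ h` takes the values of `f` along `e j`, so `le_norm` on `σ` feeds
the Abel summation on `τ`. In the constant, `1` comes from the uniform norm and `C * (k * D)` from
the variation. -/
theorem RayEnumeration.exists_comp_le (hσ : IsCSet σ) (hτ : IsCSet τ) (he : RayEnumeration k σ ∅ e)
    (he' : RayEnumeration k τ ∅ e') {h : τ → σ} (h1 : ∀ j i, h (e' j i) = e j i)
    (h2 : ∀ z : τ, (z : ℂ) = 0 → h z = ⟨0, hσ.zero_mem⟩) :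
    ∃ K : ℝ, ∀ f : σ → ℂ, IsPlanarAC f → IsPlanarAC (f ∘ h) ∧ bvNorm (f ∘ h) ≤ K * bvNorm f := by
  obtain ⟨C, hC0, hC⟩ := he'.variation_le
  obtain ⟨D, hD0, hD⟩ := he.le_norm
  refine ⟨1 + C * (k * D), fun f hf => ?_⟩
  have hbv := hf.hasBoundedPlanarVariation
  have hN := bvNorm_nonneg f
  have key := he'.isPlanarAC_of_sum_le hτ hC0 hC (g := f ∘ h) (A := D * bvNorm f)
    (fun j => by
      simp only [Function.comp_apply, h1]
      rw [h2 _ rfl]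
      exact hf.tendsto_apply hσ (he.injective_apply j))
    (fun j n => by
      simp only [Function.comp_apply, h1]
      exact hD f hbv j n)
  refine ⟨key.1, (bvNorm_le_of_le hN (by positivity) (fun z => hbv.norm_le_bvNorm _) key.2).trans
    (le_of_eq (by ring))⟩

end

/-! ### Isomorphisms induced by matching enumerations -/

/-- Composition with a map, as a homomorphism of algebras of absolutely continuous functions. -/
noncomputable def AC.compHom {σ τ : Set ℂ} (h : τ → σ)
    (hh : ∀ f : σ → ℂ, IsPlanarAC f → IsPlanarAC (f ∘ h)) : AC σ →ₐ[ℂ] AC τ where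
  toFun f := ⟨BV.mk _ (hh (BV.val σ f) ⟨f, f.2, rfl⟩).hasBoundedPlanarVariation,
    (hh (BV.val σ f) ⟨f, f.2, rfl⟩).mk_mem⟩
  map_one' := rfl
  map_mul' _ _ := rfl
  map_zero' := rfl
  map_add' _ _ := rfl
  commutes' _ := rfl

theorem AC.continuous_compHom {σ τ : Set ℂ} {h : τ → σ} {K : ℝ}
    (hh : ∀ f : σ → ℂ, IsPlanarAC f → IsPlanarAC (f ∘ h))
    (hK : ∀ f : σ → ℂ, IsPlanarAC f → bvNorm (f ∘ h) ≤ K * bvNorm f) :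
    Continuous (AC.compHom h hh) :=
  AddMonoidHomClass.continuous_of_bound (AC.compHom h hh) K fun f => hK (BV.val σ f) ⟨f, f.2, rfl⟩

theorem AC.compHom_compHom {σ τ : Set ℂ} {h : τ → σ} {h' : σ → τ} (hh' : ∀ z, h (h' z) = z)
    (hh : ∀ f : σ → ℂ, IsPlanarAC f → IsPlanarAC (f ∘ h))
    (hh2 : ∀ f : τ → ℂ, IsPlanarAC f → IsPlanarAC (f ∘ h')) (f : AC σ) :
    AC.compHom h' hh2 (AC.compHom h hh f) = f :=
  Subtype.ext (BV.val_injective σ (funext fun z => congrArg (BV.val σ f) (hh' z)))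

theorem RayEnumeration.map_map_eq {k : ℕ} {σ τ : Set ℂ} {e : Fin k → ℕ → σ} {e' : Fin k → ℕ → τ}
    (hσ : IsCSet σ) (hτ : IsCSet τ) (he' : RayEnumeration k τ ∅ e') {h : τ → σ} {h' : σ → τ}
    (h1 : ∀ j i, h (e' j i) = e j i) (h2 : ∀ z : τ, (z : ℂ) = 0 → h z = ⟨0, hσ.zero_mem⟩)
    (h1' : ∀ j i, h' (e j i) = e' j i) (h2' : ∀ z : σ, (z : ℂ) = 0 → h' z = ⟨0, hτ.zero_mem⟩)
    (z : τ) : h' (h z) = z := by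
  by_cases hz : (z : ℂ) = 0
  · rw [h2 z hz, h2' _ rfl]
    exact Subtype.ext hz.symm
  · obtain ⟨j, i, rfl⟩ := he'.exists_eq z hz (by simp)
    rw [h1, h1']

theorem RayEnumeration.nonempty_continuousAlgEquiv {k : ℕ} {σ τ : Set ℂ} (hσ : IsCSet σ)
    (hτ : IsCSet τ) {e : Fin k → ℕ → σ} {e' : Fin k → ℕ → τ} (he : RayEnumeration k σ ∅ e)
    (he' : RayEnumeration k τ ∅ e') : Nonempty (AC σ ≃A[ℂ] AC τ) := by
  obtain ⟨h, h1, h2⟩ := he'.exists_map hσ e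
  obtain ⟨h', h1', h2'⟩ := he.exists_map hτ e'
  obtain ⟨K, hK⟩ := he.exists_comp_le hσ hτ he' h1 h2
  obtain ⟨K', hK'⟩ := he'.exists_comp_le hτ hσ he h1' h2'
  have hAC := fun f hf => (hK f hf).1
  have hAC' := fun f hf => (hK' f hf).1
  exact ⟨{ AlgEquiv.ofAlgHom (AC.compHom h hAC) (AC.compHom h' hAC')
      (AlgHom.ext fun f => AC.compHom_compHom (he'.map_map_eq hσ hτ h1 h2 h1' h2') hAC' hAC f)
      (AlgHom.ext fun f => AC.compHom_compHom (he.map_map_eq hτ hσ h1' h2' h1 h2) hAC hAC' f) with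
    continuous_toFun := AC.continuous_compHom hAC fun f hf => (hK f hf).2
    continuous_invFun := AC.continuous_compHom hAC' fun f hf => (hK' f hf).2 }⟩

/-! ### Isomorphisms permute the point indicators -/

section

open Filter Topology

variable {k l : ℕ} {σ τ : Set ℂ}

/-- The inclusion of `AC(σ)` in the algebra of all functions on `σ`. -/
noncomputable def AC.toFun (σ : Set ℂ) : AC σ →ₐ[ℂ] (σ → ℂ) := (BV.val σ).comp (AC σ).val

theorem AC.toFun_injective (σ : Set ℂ) : Function.Injective (AC.toFun σ) :=
  (BV.val_injective σ).comp Subtype.val_injective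

theorem AC.isPlanarAC_toFun (f : AC σ) : IsPlanarAC (AC.toFun σ f) := ⟨f, f.2, rfl⟩

/-- An absolutely continuous function as an element of `AC(σ)`. -/
def IsPlanarAC.toAC {f : σ → ℂ} (hf : IsPlanarAC f) : AC σ := ⟨BV.mk f _, hf.mk_mem⟩

@[simp] theorem IsPlanarAC.toFun_toAC {f : σ → ℂ} (hf : IsPlanarAC f) :
    AC.toFun σ hf.toAC = f := rfl

theorem IsPlanarAC.norm_toAC {f : σ → ℂ} (hf : IsPlanarAC f) : ‖hf.toAC‖ = bvNorm f := rfl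

theorem AC.norm_eq (f : AC σ) : ‖f‖ = bvNorm (AC.toFun σ f) := rfl

/-- The indicator function of an isolated point as an element of `AC(σ)`. -/
noncomputable def AC.point (hσ : IsCSet σ) {p : σ} (hp : (p : ℂ) ≠ 0) : AC σ :=
  (hσ.isPlanarAC_pointIndicator hp).toAC

@[simp] theorem AC.toFun_point (hσ : IsCSet σ) {p : σ} (hp : (p : ℂ) ≠ 0) :
    AC.toFun σ (AC.point hσ hp) = pointIndicator p := rfl

theorem pointIndicator_injective {α : Type*} :
    Function.Injective (pointIndicator : α → α → ℂ) := fun p q h => by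
  by_contra hne
  have := congrFun h p
  rw [pointIndicator_self, pointIndicator_of_ne hne] at this
  exact one_ne_zero this

theorem AC.point_mul_point (hσ : IsCSet σ) {p : σ} (hp : (p : ℂ) ≠ 0) :
    AC.point hσ hp * AC.point hσ hp = AC.point hσ hp := by
  refine AC.toFun_injective σ (funext fun z => ?_)
  rw [map_mul, Pi.mul_apply, AC.toFun_point]
  by_cases h : z = p
  · subst h
    simp
  · simp [pointIndicator_of_ne h]

/-- The ideal generated by a point indicator is one-dimensional. This algebraic property lets an
isomorphism recognise isolated points. -/
theorem AC.mul_point (hσ : IsCSet σ) {p : σ} (hp : (p : ℂ) ≠ 0) (w : AC σ) :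
    w * AC.point hσ hp = AC.toFun σ w p • AC.point hσ hp := by
  refine AC.toFun_injective σ (funext fun z => ?_)
  rw [map_mul, map_smul, Pi.mul_apply, Pi.smul_apply, AC.toFun_point, smul_eq_mul]
  by_cases h : z = p
  · subst h
    simp
  · simp [pointIndicator_of_ne h]

theorem AC.point_ne_zero (hσ : IsCSet σ) {p : σ} (hp : (p : ℂ) ≠ 0) : AC.point hσ hp ≠ 0 := fun h => by
  have := congrFun (congrArg (AC.toFun σ) h) p
  simp at this

/-- A function vanishing at all nonzero points also vanishes at `0`, by continuity along `e`. -/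
theorem AC.exists_apply_ne_zero (hσ : IsCSet σ) {e : ℕ → σ} (he : Function.Injective e)
    (he0 : ∀ i, (e i : ℂ) ≠ 0) {w : AC σ} (hw : w ≠ 0) :
    ∃ p : σ, (p : ℂ) ≠ 0 ∧ AC.toFun σ w p ≠ 0 := by
  by_contra! hcon
  refine hw (AC.toFun_injective σ (funext fun z => ?_))
  rw [map_zero, Pi.zero_apply]
  by_cases hz : (z : ℂ) = 0
  · have h := (AC.isPlanarAC_toFun w).tendsto_apply hσ he
    simp only [hcon _ (he0 _)] at h
    rw [show z = ⟨0, hσ.zero_mem⟩ from Subtype.ext hz]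
    exact tendsto_nhds_unique h tendsto_const_nhds
  · exact hcon z hz

/-- An isomorphism maps indicator functions of isolated points to such functions. -/
theorem AC.exists_map_point_eq (hσ : IsCSet σ) (hτ : IsCSet τ) {e : ℕ → σ}
    (he : Function.Injective e) (he0 : ∀ i, (e i : ℂ) ≠ 0) (Φ : AC σ ≃ₐ[ℂ] AC τ) {q : τ}
    (hq : (q : ℂ) ≠ 0) : ∃ (p : σ) (hp : (p : ℂ) ≠ 0), Φ (AC.point hσ hp) = AC.point hτ hq := by
  have hw : Φ.symm (AC.point hτ hq) ≠ 0 := by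
    rw [ne_eq, EmbeddingLike.map_eq_zero_iff]
    exact AC.point_ne_zero hτ hq
  obtain ⟨p, hp, hwp⟩ := AC.exists_apply_ne_zero hσ he he0 hw
  refine ⟨p, hp, ?_⟩
  -- With `w` the preimage of the indicator of `q`, apply `Φ` to the identity of `w * 1_p` with `w p
  -- • 1_p` and evaluate the left side by `AC.mul_point` in `τ`: `Φ 1_p` is a multiple of `1_q`. Its
  -- coefficient is idempotent and nonzero, hence `1`.
  have h1 := congrArg Φ (AC.mul_point hσ hp (Φ.symm (AC.point hτ hq)))
  rw [map_mul, AlgEquiv.apply_symm_apply, map_smul, mul_comm, AC.mul_point] at h1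
  set c := AC.toFun τ (Φ (AC.point hσ hp)) q with hc
  set d := AC.toFun σ (Φ.symm (AC.point hτ hq)) p with hd
  have h2 : Φ (AC.point hσ hp) = (d⁻¹ * c) • AC.point hτ hq := by
    rw [mul_smul, h1, inv_smul_smul₀ hwp]
  have h3 : c = d⁻¹ * c := by
    have := congrFun (congrArg (AC.toFun τ) h2) q
    rwa [map_smul, Pi.smul_apply, AC.toFun_point, pointIndicator_self, smul_eq_mul, mul_one] at this
  have hc0 : c ≠ 0 := fun h0 => by
    rw [h0, mul_zero, zero_smul, EmbeddingLike.map_eq_zero_iff] at h2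
    exact AC.point_ne_zero hσ hp h2
  have h4 : c * c = c := by
    have := congrFun (congrArg (AC.toFun τ) (congrArg Φ (AC.point_mul_point hσ hp))) q
    rwa [map_mul, map_mul, Pi.mul_apply] at this
  rw [h2, ← h3, mul_left_cancel₀ hc0 (h4.trans (mul_one c).symm), one_smul]

/-! ### The number of rays is an invariant -/

theorem tendsto_initialIndicator {α : Type*} {q : ℕ → α} (hq : Function.Injective q) (z : α) :
    Tendsto (fun n => initialIndicator q n z) atTop (𝓝 ((Set.range q).indicator 1 z)) := by
  refine tendsto_const_nhds.congr' ?_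
  by_cases h : z ∈ Set.range q
  · obtain ⟨i, rfl⟩ := h
    filter_upwards [eventually_gt_atTop i] with n hn
    rw [initialIndicator_apply hq, if_pos hn]
    simp
  · refine Eventually.of_forall fun n => ?_
    exact (Set.indicator_of_notMem h _).trans (initialIndicator_apply_of_forall_ne n fun i hi => h ⟨i, hi⟩).symm

/-- Every summand is `0` or `1`, so a bounded sum allows only finitely many changes of membership.
-/
theorem eventually_mem_or_eventually_notMem {α : Type*} {S : Set α} {e : ℕ → α} {A : ℝ}
    (h : ∀ n, ∑ i ∈ Finset.range n, ‖S.indicator (1 : α → ℂ) (e (i + 1)) - S.indicator 1 (e i)‖ ≤ A) :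
    (∀ᶠ i in atTop, e i ∈ S) ∨ ∀ᶠ i in atTop, e i ∉ S := by
  have hs := (summable_of_sum_range_le (fun _ => norm_nonneg _) h).tendsto_atTop_zero
  obtain ⟨N, hN⟩ := eventually_atTop.1 (hs.eventually_lt_const zero_lt_one)
  have hstep : ∀ i ≥ N, (e (i + 1) ∈ S ↔ e i ∈ S) := fun i hi => by
    have := hN i hi
    by_cases h1 : e (i + 1) ∈ S <;> by_cases h2 : e i ∈ S <;> simp_all
  have hall : ∀ i ≥ N, (e i ∈ S ↔ e N ∈ S) := fun i hi => by
    induction i, hi using Nat.le_induction with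
    | base => rfl
    | succ i hi ih => rw [hstep i hi, ih]
  by_cases hmem : e N ∈ S
  · exact Or.inl ((eventually_ge_atTop N).mono fun i hi => (hall i hi).2 hmem)
  · exact Or.inr ((eventually_ge_atTop N).mono fun i hi => fun h => hmem ((hall i hi).1 h))

theorem RayEnumeration.le_of_continuousAlgEquiv (hl : 0 < l) (hσ : IsCSet σ)
    (hτ : IsCSet τ) {e : Fin k → ℕ → σ} {e' : Fin l → ℕ → τ} (he : RayEnumeration k σ ∅ e)
    (he' : RayEnumeration l τ ∅ e') (Φ : AC σ ≃A[ℂ] AC τ) : k ≤ l := by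
  have hex : ∀ j i, ∃ (q : τ) (hq : (q : ℂ) ≠ 0),
      Φ (AC.point hσ (he.ne_zero j i)) = AC.point hτ hq := fun j i => by
    obtain ⟨q, hq, h⟩ := AC.exists_map_point_eq hτ hσ (he'.injective_apply ⟨0, hl⟩)
      (he'.ne_zero ⟨0, hl⟩) Φ.toAlgEquiv.symm (he.ne_zero j i)
    exact ⟨q, hq, by rw [← h]; exact (Φ.toAlgEquiv.apply_symm_apply _)⟩
  choose q hq hΦ using hex
  have hqinj : ∀ {j i j' i'}, q j i = q j' i' → j = j' ∧ i = i' := fun {j i j' i'} h => by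
    have h1 : Φ (AC.point hσ (he.ne_zero j i)) = Φ (AC.point hσ (he.ne_zero j' i')) := by
      rw [hΦ, hΦ]
      exact AC.toFun_injective τ (by simp [h])
    have h2 := congrArg (AC.toFun σ) (Φ.toAlgEquiv.injective h1)
    rw [AC.toFun_point, AC.toFun_point] at h2
    have := he.injective (a₁ := (j, i)) (a₂ := (j', i')) (pointIndicator_injective h2)
    rwa [Prod.mk.injEq] at this
  have hqj : ∀ j, Function.Injective (q j) := fun j a b h => (hqinj h).2
  obtain ⟨C, hC0, hC⟩ := he.variation_le
  obtain ⟨D, hD0, hD⟩ := he'.le_norm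
  let T : AC σ →L[ℂ] AC τ := ⟨Φ.toAlgEquiv.toLinearMap, Φ.continuous_toFun⟩
  have hT : ∀ j n, AC.toFun τ (T (IsPlanarAC.initialIndicator hσ he j n).toAC) =
      initialIndicator (q j) n := fun j n => by
    have : (IsPlanarAC.initialIndicator hσ he j n).toAC =
        ∑ i ∈ Finset.range n, AC.point hσ (he.ne_zero j i) :=
      AC.toFun_injective σ (by simp [map_sum, initialIndicator])
    rw [this, map_sum, map_sum, initialIndicator]
    refine Finset.sum_congr rfl fun i _ => ?_
    rw [← AC.toFun_point hτ (hq j i), ← hΦ]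
    rfl
  have hbound : ∀ j n, bvNorm (initialIndicator (q j) n) ≤ ‖T‖ * (1 + C) := fun j n => by
    rw [← hT, ← AC.norm_eq]
    refine (T.le_opNorm _).trans (mul_le_mul_of_nonneg_left ?_ (norm_nonneg _))
    rw [IsPlanarAC.norm_toAC]
    exact bvNorm_le_of_le zero_le_one hC0 (norm_initialIndicator_le_one (he.injective_apply j) n)
      (hC j n)
  -- The indicator of the whole range is not in `AC τ`, being discontinuous at `0`, so `Φ` cannot
  -- produce it. It is instead a pointwise limit of initial indicators of bounded norm, and finite
  -- sums along `e' m` pass to that limit.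
  have hvar : ∀ j m n, ∑ i ∈ Finset.range n, ‖(Set.range (q j)).indicator (1 : τ → ℂ) (e' m (i + 1)) -
      (Set.range (q j)).indicator 1 (e' m i)‖ ≤ D * (‖T‖ * (1 + C)) := fun j m n => by
    refine le_of_tendsto (tendsto_finsetSum _ fun i _ =>
      ((tendsto_initialIndicator (hqj j) (e' m (i + 1))).sub
        (tendsto_initialIndicator (hqj j) (e' m i))).norm) (Eventually.of_forall fun N => ?_)
    refine (hD _ ?_ m n).trans (mul_le_mul_of_nonneg_left (hbound j N) hD0)
    rw [← hT]
    exact (AC.isPlanarAC_toFun _).hasBoundedPlanarVariation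
  -- If all `l` sequences were eventually outside the range of `q j`, that range would be finite,
  -- although `q j` is injective.
  have hm : ∀ j, ∃ m, ∀ᶠ i in atTop, e' m i ∈ Set.range (q j) := fun j => by
    by_contra! hcon
    have hev : ∀ m, ∀ᶠ i in atTop, e' m i ∉ Set.range (q j) := fun m =>
      (eventually_mem_or_eventually_notMem (hvar j m)).resolve_left (Filter.not_eventually.2 (hcon m))
    simp only [eventually_atTop] at hev
    choose N hN using hev
    refine Set.infinite_range_of_injective (hqj j) ((Set.finite_iUnion fun m =>
      (Set.finite_Iio (N m)).image (e' m)).subset ?_)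
    rintro _ ⟨i, rfl⟩
    obtain ⟨m, i', h⟩ := he'.exists_eq (q j i) (hq j i) (by simp)
    refine Set.mem_iUnion.2 ⟨m, i', ?_, h⟩
    by_contra hlt
    exact hN m i' (not_lt.1 hlt) ⟨i, h.symm⟩
  choose m hm using hm
  -- A sequence eventually inside two of the ranges would give a common point, but ranges with
  -- different indices are disjoint.
  have hinj : Function.Injective m := fun j j' h => by
    have h2 := hm j'
    rw [← h] at h2
    obtain ⟨i, ⟨a, ha⟩, b, hb⟩ := ((hm j).and h2).exists
    exact (hqinj (ha.trans hb.symm)).1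
  simpa using Fintype.card_le_of_injective m hinj

end

theorem mainTheorem1 (k l : ℕ) (σ τ : Set ℂ) (hσ : IsRaySet k σ) (hτ : IsRaySet l τ) :
    Nonempty (AC σ ≃A[ℂ] AC τ) ↔ k = l := by
  obtain ⟨e, he⟩ := hσ.exists_rayEnumeration
  obtain ⟨e', he'⟩ := hτ.exists_rayEnumeration
  constructor
  · rintro ⟨Φ⟩
    exact le_antisymm (he.le_of_continuousAlgEquiv hτ.2.1 hσ.1 hτ.1 he' Φ)
      (he'.le_of_continuousAlgEquiv hσ.2.1 hτ.1 hσ.1 he Φ.symm)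
  · rintro rfl
    exact he.nonempty_continuousAlgEquiv hσ.1 hτ.1 he'
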